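/- Let $n$ and $m$ be integers with $1\le m\le n$, let $\theta\in(0,1]$ and $\lambda\in[0,m]$ be real, and let $E\subset\mathbb{R}^n$ be compact and non-empty. Write $|\cdot|$ for the Euclidean norm, and $|U|$ for the diameter of a set $U$. The lower (resp. upper) $\theta$-intermediate dimension of a bounded non-empty set $F\subset\mathbb{R}^n$, denoted $\underline{\dim}_\theta F$ (resp. $\overline{\dim}_\theta F$), is the infimum of all $s\ge 0$ with the following property: for all $\varepsilon>0$ and all $r_0>0$ there is $0<r\le r_0$ (resp. for all $\varepsilon>0$ there is $r_0>0$ such that for all $0<r\le r_0$) there exists a cover $\{U_i\}$ of $F$ with $r^{1/\theta}\le |U_i|\le r$ for all $i$ and $\sum_i |U_i|^s\le\varepsilon$. For $0<r<1$ and real $0\le s\le t$ let $$\phi_{r,\theta}^{s,t}(x)=\begin{cases}1 & |x|<r,\\ (r/|x|)^s & r\le |x|<r^\theta,\\ r^{\theta(t-s)+s}/|x|^t & r\le|x|,\ r^\theta\le |x|,\end{cases}\qquad C_{r,\theta}^{s,t}(E)=\Big(\inf_{\mu}\iint \phi_{r,\theta}^{s,t}(x-y)\,d\mu(x)\,d\mu(y)\Big)^{-1},$$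 the infimum being over all Borel probability measures $\mu$ supported on $E$. For $t\ge 0$ the lower (resp. upper) intermediate dimension profile $\underline{\dim}_\theta^{t}E$ (resp. $\overline{\dim}_\theta^{t}E$) is the unique $s\in[0,t]$ such that $\liminf_{r\to0}\frac{\log C_{r,\theta}^{s,t}(E)}{-\log r}=s$ (resp. the same with $\limsup$). In particular both profiles are $0$ for $t=0$. Let $G(n,m)$ be the Grassmannian of $m$-dimensional linear subspaces $V$ of $\mathbb{R}^n$, let $\pi_V$ be the orthogonal projection onto $V$, and let $G(n,m)$ carry the metric $d(V,W)=\|\pi_V-\pi_W\|$ (operator norm). Then $$\dim_{\mathrm H}\{V\in G(n,m):\overline{\dim}_\theta\,\pi_V E<\overline{\dim}_\theta^{\lambda}E\}\le m(n-m)-(m-\lambda)$$ and $$\dim_{\mathrm H}\{V\in G(n,m):\underline{\dim}_\theta\,\pi_V E<\underline{\dim}_\theta^{\lambda}E\}\le m(n-m)-(m-\lambda),$$ with the convention $\dim_{\mathrm H}\emptyset=-\infty$; thus the sets are empty whenever the right-hand side is negative. -/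

import Mathlib

open Set Filter Topology MeasureTheory
open scoped ENNReal NNReal

/-- Euclidean space `ℝⁿ`. -/
abbrev RSpace (n : ℕ) : Type := EuclideanSpace ℝ (Fin n)

/-! ### The Grassmannian as a metric space -/

/-- The Grassmannian `G(n, m)` of `m`-dimensional linear subspaces of `ℝⁿ`. -/
def Grassmannian (n m : ℕ) : Type :=
  {V : Submodule ℝ (RSpace n) // Module.finrank ℝ V = m}

/-- Orthogonal projection `π_V : ℝⁿ → V`, seen as a map `ℝⁿ → ℝⁿ`. -/
noncomputable def Grassmannian.proj {n m : ℕ} (V : Grassmannian n m) :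
    RSpace n →L[ℝ] RSpace n :=
  V.1.starProjection

theorem Grassmannian.proj_injective (n m : ℕ) :
    Function.Injective (Grassmannian.proj : Grassmannian n m → (RSpace n →L[ℝ] RSpace n)) := by
  intro V W h
  exact Subtype.ext (Submodule.starProjection_inj.1 h)

/-- The usual metric on `G(n, m)`: `d(V, W) = ‖π_V - π_W‖` (operator norm). -/
noncomputable instance Grassmannian.instMetricSpace (n m : ℕ) : MetricSpace (Grassmannian n m) :=
  MetricSpace.induced Grassmannian.proj (Grassmannian.proj_injective n m) inferInstance

/-- The assertion `dim_H A ≤ d` for a real number `d` which is allowed to be negative. The empty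
set satisfies it for every `d` (its dimension counts as `-∞`); a non-empty set satisfies it
only if `d ≥ 0`. -/
def HausdorffDimLE {X : Type*} [MetricSpace X] (A : Set X) (d : ℝ) : Prop :=
  A.Nonempty → ((dimH A : ℝ≥0∞) : EReal) ≤ (d : EReal)

/-! ### Intermediate dimensions -/

/-- `E` has a cover `{U_i}` with `a ≤ |U_i| ≤ b` for all `i` and `∑ |U_i| ^ s ≤ ε`.
It is used for `0 < a` and `0 ≤ s` only: then the sum has finitely many terms, and the
sets `U_i` are bounded since `Metric.diam` of an unbounded set is `0`. -/
def HasCover {n : ℕ} (E : Set (RSpace n)) (a b s ε : ℝ) : Prop :=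
  ∃ 𝒰 : Finset (Set (RSpace n)), E ⊆ ⋃ U ∈ 𝒰, U ∧
    (∀ U ∈ 𝒰, a ≤ Metric.diam U ∧ Metric.diam U ≤ b) ∧
    ∑ U ∈ 𝒰, Metric.diam U ^ s ≤ ε

/-- The lower `θ`-intermediate dimension of a bounded non-empty set, `0 < θ ≤ 1`. -/
noncomputable def lowerIntermediateDim {n : ℕ} (θ : ℝ) (E : Set (RSpace n)) : ℝ :=
  sInf {s : ℝ | 0 ≤ s ∧ ∀ ε : ℝ, 0 < ε → ∀ r₀ : ℝ, 0 < r₀ →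
    ∃ r : ℝ, 0 < r ∧ r ≤ r₀ ∧ HasCover E (r ^ (1 / θ)) r s ε}

/-- The upper `θ`-intermediate dimension of a bounded non-empty set, `0 < θ ≤ 1`. -/
noncomputable def upperIntermediateDim {n : ℕ} (θ : ℝ) (E : Set (RSpace n)) : ℝ :=
  sInf {s : ℝ | 0 ≤ s ∧ ∀ ε : ℝ, 0 < ε → ∃ r₀ : ℝ, 0 < r₀ ∧
    ∀ r : ℝ, 0 < r → r ≤ r₀ → HasCover E (r ^ (1 / θ)) r s ε}

/-! ### Capacities and dimension profiles -/

/-- The kernel `φ_{r,θ}^{s,t}` on `ℝⁿ`, for `0 < r < 1`, `0 < θ ≤ 1` and `0 ≤ s ≤ t`. -/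
noncomputable def kernel {n : ℕ} (r θ s t : ℝ) (x : RSpace n) : ℝ :=
  if ‖x‖ < r then 1
  else if ‖x‖ < r ^ θ then (r / ‖x‖) ^ s
  else r ^ (θ * (t - s) + s) / ‖x‖ ^ t

/-- The energy `∬ φ_{r,θ}^{s,t}(x - y) dμ(x) dμ(y)`. -/
noncomputable def energy {n : ℕ} (r θ s t : ℝ) (μ : Measure (RSpace n)) : ℝ≥0∞ :=
  ∫⁻ x, ∫⁻ y, ENNReal.ofReal (kernel r θ s t (x - y)) ∂μ ∂μ

/-- The capacity `C_{r,θ}^{s,t}(E)` of a compact set `E`: the reciprocal of the infimum of the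
energies of the Borel probability measures supported on `E`. -/
noncomputable def capacity {n : ℕ} (r θ s t : ℝ) (E : Set (RSpace n)) : ℝ≥0∞ :=
  (⨅ μ : Measure (RSpace n), ⨅ _ : IsProbabilityMeasure μ ∧ μ Eᶜ = 0, energy r θ s t μ)⁻¹

/-- The quotient `log C_{r,θ}^{s,t}(E) / (- log r)`. -/
noncomputable def capacityRate {n : ℕ} (θ s t : ℝ) (E : Set (RSpace n)) (r : ℝ) : ℝ :=
  Real.log (capacity r θ s t E).toReal / (-Real.log r)

/-- `liminf_{r → 0+} log C_{r,θ}^{s,t}(E) / (- log r)`, in the extended reals. -/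
noncomputable def lowerCapacityExponent {n : ℕ} (θ s t : ℝ) (E : Set (RSpace n)) : EReal :=
  liminf (fun r : ℝ => (capacityRate θ s t E r : EReal)) (𝓝[>] (0 : ℝ))

/-- `limsup_{r → 0+} log C_{r,θ}^{s,t}(E) / (- log r)`, in the extended reals. -/
noncomputable def upperCapacityExponent {n : ℕ} (θ s t : ℝ) (E : Set (RSpace n)) : EReal :=
  limsup (fun r : ℝ => (capacityRate θ s t E r : EReal)) (𝓝[>] (0 : ℝ))

/-- The lower intermediate dimension profile: the unique `s ∈ [0, t]` with
`liminf_{r → 0+} log C_{r,θ}^{s,t}(E) / (- log r) = s`. For `t = 0` it is `0`. Existence and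
uniqueness are proved in `existsUnique_lowerProfile`. -/
noncomputable def lowerProfile {n : ℕ} (θ t : ℝ) (E : Set (RSpace n)) : ℝ :=
  Classical.epsilon fun s : ℝ => s ∈ Icc 0 t ∧ lowerCapacityExponent θ s t E = (s : EReal)

/-- The upper intermediate dimension profile: the unique `s ∈ [0, t]` with
`limsup_{r → 0+} log C_{r,θ}^{s,t}(E) / (- log r) = s`. For `t = 0` it is `0`. Existence and
uniqueness are proved in `existsUnique_upperProfile`. -/
noncomputable def upperProfile {n : ℕ} (θ t : ℝ) (E : Set (RSpace n)) : ℝ :=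
  Classical.epsilon fun s : ℝ => s ∈ Icc 0 t ∧ upperCapacityExponent θ s t E = (s : EReal)

/-! ### The profiles are well defined -/

theorem kernel_le_one {n : ℕ} {r θ s t : ℝ} (hr : 0 < r) (hr1 : r < 1) (hθ1 : θ ≤ 1)
    (hs : 0 ≤ s) (hst : s ≤ t) (x : RSpace n) : kernel r θ s t x ≤ 1 := by
  unfold kernel
  split_ifs with h1 h2
  · exact le_rfl
  · have h1 := not_lt.1 h1
    exact Real.rpow_le_one (by positivity) ((div_le_one (hr.trans_le h1)).2 h1) hs
  · have h1 := not_lt.1 h1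
    have h2 := not_lt.1 h2
    have hx : 0 < ‖x‖ := hr.trans_le h1
    rw [div_le_one (by positivity)]
    calc r ^ (θ * (t - s) + s) ≤ r ^ (θ * t) :=
          Real.rpow_le_rpow_of_exponent_ge hr hr1.le (by nlinarith)
      _ = (r ^ θ) ^ t := Real.rpow_mul hr.le _ _
      _ ≤ ‖x‖ ^ t := Real.rpow_le_rpow (by positivity) h2 (hs.trans hst)

theorem kernel_compare {n : ℕ} {r θ s s' t : ℝ} (hr : 0 < r) (hr1 : r < 1) (hθ1 : θ ≤ 1)
    (hss : s ≤ s') (x : RSpace n) :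
    kernel r θ s' t x ≤ kernel r θ s t x ∧
      r ^ ((1 - θ) * (s' - s)) * kernel r θ s t x ≤ kernel r θ s' t x := by
  have hexp : 0 ≤ (1 - θ) * (s' - s) := mul_nonneg (by linarith) (by linarith)
  unfold kernel
  split_ifs with h1 h2
  · exact ⟨le_rfl, by rw [mul_one]; exact Real.rpow_le_one hr.le hr1.le hexp⟩
  · have h1 := not_lt.1 h1
    have hx : 0 < ‖x‖ := hr.trans_le h1
    have hq : 0 < r / ‖x‖ := by positivity
    have hq1 : r / ‖x‖ ≤ 1 := (div_le_one hx).2 h1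
    refine ⟨Real.rpow_le_rpow_of_exponent_ge hq hq1 hss, ?_⟩
    have hb : r ^ (1 - θ) ≤ r / ‖x‖ := by
      rw [le_div_iff₀ hx]
      calc r ^ (1 - θ) * ‖x‖ ≤ r ^ (1 - θ) * r ^ θ := by gcongr
        _ = r := by rw [← Real.rpow_add hr]; simp
    calc r ^ ((1 - θ) * (s' - s)) * (r / ‖x‖) ^ s
        = (r ^ (1 - θ)) ^ (s' - s) * (r / ‖x‖) ^ s := by rw [Real.rpow_mul hr.le]
      _ ≤ (r / ‖x‖) ^ (s' - s) * (r / ‖x‖) ^ s := by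
          gcongr
      _ = (r / ‖x‖) ^ s' := by rw [← Real.rpow_add hq]; simp
  · have h1 := not_lt.1 h1
    have hx : 0 < ‖x‖ := hr.trans_le h1
    constructor
    · gcongr ?_ / _
      exact Real.rpow_le_rpow_of_exponent_ge hr hr1.le (by nlinarith)
    · rw [← mul_div_assoc, ← Real.rpow_add hr]
      apply le_of_eq
      congr 2
      ring

theorem kernel_lower {n : ℕ} {r θ s t B : ℝ} (hr : 0 < r) (hr1 : r < 1) (hθ1 : θ ≤ 1)
    (hs : 0 ≤ s) (hst : s ≤ t) (hB : 1 ≤ B) (x : RSpace n) (hx : ‖x‖ ≤ B) :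
    B ^ (-t) * r ^ t ≤ kernel r θ s t x := by
  have ht : 0 ≤ t := hs.trans hst
  have hB0 : 0 < B := by linarith
  refine le_trans ?_ (kernel_compare hr hr1 hθ1 hst x).1
  have key : ∀ y : ℝ, 0 < y → y ≤ B → B ^ (-t) * r ^ t ≤ r ^ t / y ^ t := by
    intro y hy hyB
    rw [Real.rpow_neg hB0.le, ← div_eq_inv_mul]
    gcongr
  unfold kernel
  split_ifs with h1 h2
  · have h3 : B ^ (-t) ≤ 1 := Real.rpow_le_one_of_one_le_of_nonpos hB (by linarith)
    have h4 : r ^ t ≤ 1 := Real.rpow_le_one hr.le hr1.le ht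
    have h5 : 0 ≤ r ^ t := by positivity
    nlinarith
  · have hx0 : 0 < ‖x‖ := hr.trans_le (not_lt.1 h1)
    rw [Real.div_rpow hr.le hx0.le]
    exact key _ hx0 hx
  · have hx0 : 0 < ‖x‖ := hr.trans_le (not_lt.1 h1)
    rw [sub_self, mul_zero, zero_add]
    exact key _ hx0 hx

theorem energy_mono {n : ℕ} {r θ s s' t : ℝ} (hr : 0 < r) (hr1 : r < 1) (hθ1 : θ ≤ 1)
    (hss : s ≤ s') (μ : Measure (RSpace n)) : energy r θ s' t μ ≤ energy r θ s t μ :=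
  lintegral_mono fun x => lintegral_mono fun y =>
    ENNReal.ofReal_le_ofReal (kernel_compare hr hr1 hθ1 hss (x - y)).1

theorem energy_compare {n : ℕ} {r θ s s' t : ℝ} (hr : 0 < r) (hr1 : r < 1) (hθ1 : θ ≤ 1)
    (hss : s ≤ s') (μ : Measure (RSpace n)) :
    ENNReal.ofReal (r ^ ((1 - θ) * (s' - s))) * energy r θ s t μ ≤ energy r θ s' t μ := by
  unfold energy
  rw [← lintegral_const_mul' _ _ ENNReal.ofReal_ne_top]
  refine lintegral_mono fun x => ?_
  simp only
  rw [← lintegral_const_mul' _ _ ENNReal.ofReal_ne_top]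
  refine lintegral_mono fun y => ?_
  simp only
  rw [← ENNReal.ofReal_mul (by positivity)]
  exact ENNReal.ofReal_le_ofReal (kernel_compare hr hr1 hθ1 hss (x - y)).2

theorem capacity_mono {n : ℕ} {r θ s s' t : ℝ} (hr : 0 < r) (hr1 : r < 1) (hθ1 : θ ≤ 1)
    (hss : s ≤ s') (E : Set (RSpace n)) : capacity r θ s t E ≤ capacity r θ s' t E := by
  unfold capacity
  rw [ENNReal.inv_le_inv]
  exact iInf₂_mono fun μ _ => energy_mono hr hr1 hθ1 hss μ

theorem capacity_compare {n : ℕ} {r θ s s' t : ℝ} (hr : 0 < r) (hr1 : r < 1) (hθ1 : θ ≤ 1)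
    (hss : s ≤ s') (E : Set (RSpace n)) :
    ENNReal.ofReal (r ^ ((1 - θ) * (s' - s))) * capacity r θ s' t E ≤ capacity r θ s t E := by
  have hpos : 0 < r ^ ((1 - θ) * (s' - s)) := by positivity
  have h0 : ENNReal.ofReal (r ^ ((1 - θ) * (s' - s))) ≠ 0 := by simpa using hpos
  rw [mul_comm, ← ENNReal.le_div_iff_mul_le (Or.inl h0) (Or.inl ENNReal.ofReal_ne_top)]
  unfold capacity
  rw [div_eq_mul_inv, ← ENNReal.mul_inv (Or.inr ENNReal.ofReal_ne_top) (Or.inr h0),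
    ENNReal.inv_le_inv]
  refine le_iInf₂ fun μ hμ => ?_
  refine le_trans ?_ (energy_compare hr hr1 hθ1 hss μ)
  rw [mul_comm]
  gcongr
  exact iInf₂_le μ hμ

theorem one_le_capacity {n : ℕ} {r θ s t : ℝ} (hr : 0 < r) (hr1 : r < 1) (hθ1 : θ ≤ 1)
    (hs : 0 ≤ s) (hst : s ≤ t) {E : Set (RSpace n)} (hE : E.Nonempty) :
    1 ≤ capacity r θ s t E := by
  obtain ⟨a, ha⟩ := hE
  unfold capacity
  rw [ENNReal.one_le_inv]
  have hμ : IsProbabilityMeasure (Measure.dirac a) ∧ (Measure.dirac a) Eᶜ = 0 := by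
    refine ⟨inferInstance, ?_⟩
    rw [Measure.dirac_apply]
    simp [ha]
  refine (iInf₂_le (Measure.dirac a) hμ).trans ?_
  unfold energy
  calc ∫⁻ x, ∫⁻ y, ENNReal.ofReal (kernel r θ s t (x - y)) ∂(Measure.dirac a) ∂(Measure.dirac a)
      ≤ ∫⁻ _x, ∫⁻ _y, 1 ∂(Measure.dirac a) ∂(Measure.dirac a) :=
        lintegral_mono fun x => lintegral_mono fun y => by
          simpa using kernel_le_one hr hr1 hθ1 hs hst (x - y)
    _ = 1 := by simp

theorem capacity_le {n : ℕ} {r θ s t B : ℝ} (hr : 0 < r) (hr1 : r < 1) (hθ1 : θ ≤ 1)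
    (hs : 0 ≤ s) (hst : s ≤ t) (hB : 1 ≤ B) {E : Set (RSpace n)}
    (hE : ∀ x ∈ E, ∀ y ∈ E, ‖x - y‖ ≤ B) :
    capacity r θ s t E ≤ ENNReal.ofReal (B ^ t * r ^ (-t)) := by
  have hB0 : 0 < B := by linarith
  have hinv : B ^ t * r ^ (-t) = (B ^ (-t) * r ^ t)⁻¹ := by
    rw [Real.rpow_neg hr.le, Real.rpow_neg hB0.le, mul_inv, inv_inv]
  rw [hinv, ENNReal.ofReal_inv_of_pos (by positivity)]
  unfold capacity
  rw [ENNReal.inv_le_inv]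
  refine le_iInf₂ fun μ hμ => ?_
  have := hμ.1
  have hae : ∀ᵐ x ∂μ, x ∈ E := hμ.2
  unfold energy
  calc ENNReal.ofReal (B ^ (-t) * r ^ t)
      = ∫⁻ _x, ∫⁻ _y, ENNReal.ofReal (B ^ (-t) * r ^ t) ∂μ ∂μ := by simp
    _ ≤ ∫⁻ x, ∫⁻ y, ENNReal.ofReal (kernel r θ s t (x - y)) ∂μ ∂μ := by
        refine lintegral_mono_ae ?_
        filter_upwards [hae] with x hx
        refine lintegral_mono_ae ?_
        filter_upwards [hae] with y hy
        exact ENNReal.ofReal_le_ofReal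
          (kernel_lower hr hr1 hθ1 hs hst hB (x - y) (hE x hx y hy))

theorem capacityRate_bounds {n : ℕ} {r θ s s' t B : ℝ} (hr : 0 < r) (hr1 : r < 1)
    (hθ1 : θ ≤ 1) (hs : 0 ≤ s) (hss : s ≤ s') (hst : s' ≤ t) (hB : 1 ≤ B)
    {E : Set (RSpace n)} (hne : E.Nonempty) (hE : ∀ x ∈ E, ∀ y ∈ E, ‖x - y‖ ≤ B) :
    0 ≤ capacityRate θ s t E r ∧
    capacityRate θ s t E r ≤ capacityRate θ s' t E r ∧
    capacityRate θ s' t E r ≤ (1 - θ) * (s' - s) + capacityRate θ s t E r ∧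
    capacityRate θ s t E r ≤ t + t * Real.log B / (-Real.log r) := by
  have hB0 : 0 < B := by linarith
  have hL : 0 < -Real.log r := by linarith [Real.log_neg hr hr1]
  have fin : ∀ u, 0 ≤ u → u ≤ t → capacity r θ u t E ≠ ⊤ := fun u h0 h1 =>
    ((capacity_le hr hr1 hθ1 h0 h1 hB hE).trans_lt ENNReal.ofReal_lt_top).ne
  have one : ∀ u, 0 ≤ u → u ≤ t → 1 ≤ (capacity r θ u t E).toReal := fun u h0 h1 => by
    have := ENNReal.toReal_mono (fin u h0 h1) (one_le_capacity hr hr1 hθ1 h0 h1 hne)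
    simpa using this
  have hst0 : s ≤ t := hss.trans hst
  have hs' : 0 ≤ s' := hs.trans hss
  have o1 := one s hs hst0
  have o2 := one s' hs' hst
  unfold capacityRate
  refine ⟨div_nonneg (Real.log_nonneg o1) hL.le, ?_, ?_, ?_⟩
  · gcongr
    · exact fin s' hs' hst
    · exact capacity_mono hr hr1 hθ1 hss E
  · have h := ENNReal.toReal_mono (fin s hs hst0) (capacity_compare (t := t) hr hr1 hθ1 hss E)
    rw [ENNReal.toReal_mul, ENNReal.toReal_ofReal (by positivity)] at h
    have h2 := Real.log_le_log (by positivity) h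
    rw [Real.log_mul (by positivity) (by positivity), Real.log_rpow hr] at h2
    rw [div_le_iff₀ hL, add_mul, div_mul_cancel₀ _ hL.ne']
    linarith
  · have h := ENNReal.toReal_mono ENNReal.ofReal_ne_top (capacity_le hr hr1 hθ1 hs hst0 hB hE)
    rw [ENNReal.toReal_ofReal (by positivity)] at h
    have h2 := Real.log_le_log (by positivity) h
    rw [Real.log_mul (by positivity) (by positivity), Real.log_rpow hr, Real.log_rpow hB0] at h2
    rw [div_le_iff₀ hL, add_mul, div_mul_cancel₀ _ hL.ne']
    linarith

/-- A monotone function on `[0, t]` with Lipschitz constant `1 - θ < 1` has a unique fixed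
point. -/
theorem existsUnique_fixed_of_bounds {θ t : ℝ} (hθ : 0 < θ) (ht : 0 ≤ t) (f : ℝ → EReal)
    (h0 : ∀ s ∈ Icc 0 t, 0 ≤ f s) (h1 : ∀ s ∈ Icc 0 t, f s ≤ (t : EReal))
    (hmono : ∀ s s', 0 ≤ s → s ≤ s' → s' ≤ t → f s ≤ f s')
    (hlip : ∀ s s', 0 ≤ s → s ≤ s' → s' ≤ t →
      f s' ≤ (((1 - θ) * (s' - s) : ℝ) : EReal) + f s) :
    ∃! s : ℝ, s ∈ Icc 0 t ∧ f s = (s : EReal) := by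
  have hreal : ∀ s ∈ Icc (0 : ℝ) t, ∃ y ∈ Icc (0 : ℝ) t, f s = (y : EReal) := by
    intro s hs
    have a := h0 s hs
    have b := h1 s hs
    have hb : f s ≠ ⊥ := fun h => by simp [h] at a
    have htp : f s ≠ ⊤ := fun h => by simp [h] at b
    have hc := EReal.coe_toReal htp hb
    rw [← hc] at a b
    exact ⟨(f s).toReal, ⟨by exact_mod_cast a, by exact_mod_cast b⟩, hc.symm⟩
  have huniq : ∀ s s' : ℝ, 0 ≤ s → s ≤ s' → s' ≤ t → f s = s → f s' = s' → s = s' := by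
    intro s s' a b c d e
    have h := hlip s s' a b c
    rw [d, e] at h
    have h' : s' ≤ (1 - θ) * (s' - s) + s := by exact_mod_cast h
    nlinarith
  set S : Set ℝ := {s | s ∈ Icc 0 t ∧ (s : EReal) ≤ f s} with hS
  have hS0 : (0 : ℝ) ∈ S := ⟨⟨le_rfl, ht⟩, by simpa using h0 0 ⟨le_rfl, ht⟩⟩
  have hbdd : BddAbove S := ⟨t, fun s hs => hs.1.2⟩
  have hp : sSup S ∈ Icc 0 t := ⟨le_csSup hbdd hS0, csSup_le ⟨0, hS0⟩ fun s hs => hs.1.2⟩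
  obtain ⟨y, hy, hfy⟩ := hreal _ hp
  have hle : sSup S ≤ y := by
    refine csSup_le ⟨0, hS0⟩ fun s hs => ?_
    have := hs.2.trans (hmono s (sSup S) hs.1.1 (le_csSup hbdd hs) hp.2)
    rw [hfy] at this
    exact_mod_cast this
  have hyS : y ∈ S := ⟨hy, by rw [← hfy]; exact hmono _ _ hp.1 hle hy.2⟩
  have heq : y = sSup S := le_antisymm (le_csSup hbdd hyS) hle
  refine ⟨sSup S, ⟨hp, by rw [hfy, heq]⟩, ?_⟩
  rintro s ⟨hs, hfs⟩
  have hfp : f (sSup S) = ((sSup S : ℝ) : EReal) := by rw [hfy, heq]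
  rcases le_total s (sSup S) with h | h
  · exact huniq _ _ hs.1 h hp.2 hfs hfp
  · exact (huniq _ _ hp.1 h hs.2 hfp hfs).symm

theorem eventually_small : ∀ᶠ r : ℝ in 𝓝[>] (0 : ℝ), 0 < r ∧ r < 1 := by
  filter_upwards [Ioo_mem_nhdsGT (zero_lt_one' ℝ)] with r hr using hr

theorem tendsto_rate_bound (t K : ℝ) :
    Tendsto (fun r : ℝ => ((t + K / (-Real.log r) : ℝ) : EReal)) (𝓝[>] 0) (𝓝 (t : EReal)) := by
  refine (continuous_coe_real_ereal.tendsto t).comp ?_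
  have h : Tendsto (fun r : ℝ => -Real.log r) (𝓝[>] 0) atTop :=
    tendsto_neg_atBot_atTop.comp Real.tendsto_log_nhdsGT_zero
  simpa using tendsto_const_nhds.add (h.const_div_atTop K)

theorem exists_diam_bound {n : ℕ} {E : Set (RSpace n)} (hE : IsCompact E) :
    ∃ B : ℝ, 1 ≤ B ∧ ∀ x ∈ E, ∀ y ∈ E, ‖x - y‖ ≤ B := by
  refine ⟨max 1 (Metric.diam E), le_max_left _ _, fun x hx y hy => ?_⟩
  rw [← dist_eq_norm]
  exact (Metric.dist_le_diam_of_mem hE.isBounded hx hy).trans (le_max_right _ _)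

/-- The number defining `lowerProfile` exists and is unique. -/
theorem existsUnique_lowerProfile {n : ℕ} {θ t : ℝ} (hθ : 0 < θ) (hθ1 : θ ≤ 1) (ht : 0 ≤ t)
    {E : Set (RSpace n)} (hE : IsCompact E) (hne : E.Nonempty) :
    ∃! s : ℝ, s ∈ Icc 0 t ∧ lowerCapacityExponent θ s t E = (s : EReal) := by
  obtain ⟨B, hB, hEB⟩ := exists_diam_bound hE
  refine existsUnique_fixed_of_bounds hθ ht (fun s => lowerCapacityExponent θ s t E) ?_ ?_ ?_ ?_
  · intro s hs
    refine le_liminf_of_le (by isBoundedDefault) ?_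
    filter_upwards [eventually_small] with r hr
    exact_mod_cast (capacityRate_bounds hr.1 hr.2 hθ1 hs.1 le_rfl hs.2 hB hne hEB).1
  · intro s hs
    rw [← (tendsto_rate_bound t (t * Real.log B)).liminf_eq]
    refine liminf_le_liminf ?_
    filter_upwards [eventually_small] with r hr
    exact_mod_cast (capacityRate_bounds hr.1 hr.2 hθ1 hs.1 le_rfl hs.2 hB hne hEB).2.2.2
  · intro s s' h0 h1 h2
    refine liminf_le_liminf ?_
    filter_upwards [eventually_small] with r hr
    exact_mod_cast (capacityRate_bounds hr.1 hr.2 hθ1 h0 h1 h2 hB hne hEB).2.1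
  · intro s s' h0 h1 h2
    have key : lowerCapacityExponent θ s' t E ≤
        liminf ((fun _ : ℝ => (((1 - θ) * (s' - s) : ℝ) : EReal)) +
          fun r : ℝ => (capacityRate θ s t E r : EReal)) (𝓝[>] (0 : ℝ)) := by
      refine liminf_le_liminf ?_
      filter_upwards [eventually_small] with r hr
      rw [Pi.add_apply, ← EReal.coe_add]
      exact_mod_cast (capacityRate_bounds hr.1 hr.2 hθ1 h0 h1 h2 hB hne hEB).2.2.1
    refine key.trans ((EReal.liminf_add_le ?_ ?_).trans_eq ?_)
    · rw [limsup_const]; exact Or.inl (EReal.coe_ne_bot _)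
    · rw [limsup_const]; exact Or.inl (EReal.coe_ne_top _)
    · rw [limsup_const]; rfl

/-- The number defining `upperProfile` exists and is unique. -/
theorem existsUnique_upperProfile {n : ℕ} {θ t : ℝ} (hθ : 0 < θ) (hθ1 : θ ≤ 1) (ht : 0 ≤ t)
    {E : Set (RSpace n)} (hE : IsCompact E) (hne : E.Nonempty) :
    ∃! s : ℝ, s ∈ Icc 0 t ∧ upperCapacityExponent θ s t E = (s : EReal) := by
  obtain ⟨B, hB, hEB⟩ := exists_diam_bound hE
  refine existsUnique_fixed_of_bounds hθ ht (fun s => upperCapacityExponent θ s t E) ?_ ?_ ?_ ?_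
  · intro s hs
    refine le_limsup_of_frequently_le (Eventually.frequently ?_) (by isBoundedDefault)
    filter_upwards [eventually_small] with r hr
    exact_mod_cast (capacityRate_bounds hr.1 hr.2 hθ1 hs.1 le_rfl hs.2 hB hne hEB).1
  · intro s hs
    rw [← (tendsto_rate_bound t (t * Real.log B)).limsup_eq]
    refine limsup_le_limsup ?_
    filter_upwards [eventually_small] with r hr
    exact_mod_cast (capacityRate_bounds hr.1 hr.2 hθ1 hs.1 le_rfl hs.2 hB hne hEB).2.2.2
  · intro s s' h0 h1 h2
    refine limsup_le_limsup ?_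
    filter_upwards [eventually_small] with r hr
    exact_mod_cast (capacityRate_bounds hr.1 hr.2 hθ1 h0 h1 h2 hB hne hEB).2.1
  · intro s s' h0 h1 h2
    have key : upperCapacityExponent θ s' t E ≤
        limsup ((fun _ : ℝ => (((1 - θ) * (s' - s) : ℝ) : EReal)) +
          fun r : ℝ => (capacityRate θ s t E r : EReal)) (𝓝[>] (0 : ℝ)) := by
      refine limsup_le_limsup ?_
      filter_upwards [eventually_small] with r hr
      rw [Pi.add_apply, ← EReal.coe_add]
      exact_mod_cast (capacityRate_bounds hr.1 hr.2 hθ1 h0 h1 h2 hB hne hEB).2.2.1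
    refine key.trans ((EReal.limsup_add_le ?_ ?_).trans_eq ?_)
    · rw [limsup_const]; exact Or.inl (EReal.coe_ne_bot _)
    · rw [limsup_const]; exact Or.inl (EReal.coe_ne_top _)
    · rw [limsup_const]; rfl

/-! Put D = m(n-m-1) + λ, which equals m(n-m) - (m-λ). For an exceptional V, choose a rational q
between the dimension of π_V E and the profile of E. At suitable small scales r, π_V E has a cover
by sets of diameter in [r, r^θ] with ∑ |U|^q ≤ 1/2, and the profile yields γ > 0 and a probability
measure μ on E whose energy for the kernel φ^{q,λ} is below 2r^(q+2γ). The mass distribution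
principle shows that such a cover forces the projected energy for φ^{q,m} to be at least r^(q+γ)
(`exists_measure_of_le_capacity`).

The two kernels are linked by averaging over V. For x ≠ 0 the V with |π_V x| ≤ δ|x| lie near a copy
of G(n-1, m), so about δ^(-m(n-m-1)) sets of diameter ≲ δ cover them
(`Grassmannian.exists_cells_slab`). A discrete measure giving mass at most ρ^D to ρ-balls therefore
gives them mass ≲ δ^λ, and its average of φ^{q,m}(π_V x) is at most φ^{q,λ}(x) up to a constant and
a logarithm of the scale (`Grassmannian.exists_kernel_average_bound`). Integration against μ shows
that every such measure on the subspaces bad at scale r has mass ≲ r^(γ/2). A finite Frostman lemma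
turns this into a cover of the bad set by balls with ∑ ρ^D ≲ r^(γ/2)
(`exists_hasBallCover_exceptional`).

Summation over a rapidly decreasing sequence of scales and Borel-Cantelli
(`dimH_le_of_frequently_mem`) give dimension at most D for each q, and countably many q suffice. If
m = n, the projection is the identity, the two energy bounds contradict each other, and the
exceptional sets are empty. -/

/-! ### Differences of orthogonal projections close to a fixed one. -/

section Projections

variable {F : Type*} [NormedAddCommGroup F] [InnerProductSpace ℝ F] [FiniteDimensional ℝ F]

/-- With P, P', T the projections onto V, W, U and D = P - P', idempotence gives (P-T)D + D(P'-T) =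
D - TD - DT. Compressing this to U or to Uᗮ returns the diagonal block of D up to sign, so diagonal
blocks are of second order. The two off-diagonal blocks are adjoint, so one of them controls D. -/
theorem norm_starProjection_sub_le_offDiagonal (U V W : Submodule ℝ F) {κ : ℝ}
    (hV : ‖V.starProjection - U.starProjection‖ ≤ κ)
    (hW : ‖W.starProjection - U.starProjection‖ ≤ κ) :
    ‖U.starProjection * (V.starProjection - W.starProjection) * U.starProjection‖ ≤
        2 * κ * ‖V.starProjection - W.starProjection‖ ∧
      ‖V.starProjection - W.starProjection‖ ≤ 4 * κ * ‖V.starProjection - W.starProjection‖ +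
        2 * ‖U.starProjection * (V.starProjection - W.starProjection) * Uᗮ.starProjection‖ := by
  have hQ : Uᗮ.starProjection = 1 - U.starProjection := Submodule.starProjection_orthogonal' U
  have nT : ‖U.starProjection‖ ≤ 1 := U.starProjection_norm_le
  have nQ : ‖Uᗮ.starProjection‖ ≤ 1 := Uᗮ.starProjection_norm_le
  have iT : U.starProjection * U.starProjection = U.starProjection :=
    U.isIdempotentElem_starProjection
  have iP : V.starProjection * V.starProjection = V.starProjection :=
    V.isIdempotentElem_starProjection
  have iP' : W.starProjection * W.starProjection = W.starProjection :=
    W.isIdempotentElem_starProjection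
  have sT : star U.starProjection = U.starProjection := isSelfAdjoint_starProjection U
  have sQ : star Uᗮ.starProjection = Uᗮ.starProjection := isSelfAdjoint_starProjection Uᗮ
  have sP : star V.starProjection = V.starProjection := isSelfAdjoint_starProjection V
  have sP' : star W.starProjection = W.starProjection := isSelfAdjoint_starProjection W
  set T := U.starProjection
  set Q := Uᗮ.starProjection
  set P := V.starProjection
  set P' := W.starProjection
  have triple : ∀ a b c : F →L[ℝ] F, ‖a‖ ≤ 1 → ‖c‖ ≤ 1 → ‖a * b * c‖ ≤ ‖b‖ := by
    intro a b c ha hc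
    calc ‖a * b * c‖ ≤ ‖a‖ * ‖b‖ * ‖c‖ :=
          (norm_mul_le _ _).trans (mul_le_mul_of_nonneg_right (norm_mul_le _ _) (norm_nonneg _))
      _ ≤ 1 * ‖b‖ * 1 := by gcongr
      _ = ‖b‖ := by ring
  have hκ : 0 ≤ κ := (norm_nonneg _).trans hV
  have bound : ∀ a : F →L[ℝ] F, ‖a‖ ≤ 1 →
      ‖a * ((P - T) * (P - P') + (P - P') * (P' - T)) * a‖ ≤ 2 * κ * ‖P - P'‖ := by
    intro a ha
    refine (triple _ _ _ ha ha).trans ((norm_add_le _ _).trans ?_)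
    have h1 := norm_mul_le (P - T) (P - P')
    have h2 := norm_mul_le (P - P') (P' - T)
    have h3 := mul_le_mul_of_nonneg_right hV (norm_nonneg (P - P'))
    have h4 := mul_le_mul_of_nonneg_left hW (norm_nonneg (P - P'))
    linarith
  have e1 : T * (P - P') * T = -(T * ((P - T) * (P - P') + (P - P') * (P' - T)) * T) := by
    have : T * ((P - T) * (P - P') + (P - P') * (P' - T)) * T
        = T * (P * P - P' * P') * T - (T * T) * (P - P') * T - T * (P - P') * (T * T) := by
      noncomm_ring
    rw [this, iP, iP', iT]
    noncomm_ring
  have hQT : Q * T = 0 := by rw [hQ, sub_mul, iT, one_mul, sub_self]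
  have hTQ : T * Q = 0 := by rw [hQ, mul_sub, iT, mul_one, sub_self]
  have e2 : Q * (P - P') * Q = Q * ((P - T) * (P - P') + (P - P') * (P' - T)) * Q := by
    have : Q * ((P - T) * (P - P') + (P - P') * (P' - T)) * Q
        = Q * (P * P - P' * P') * Q - (Q * T) * (P - P') * Q - Q * (P - P') * (T * Q) := by
      noncomm_ring
    rw [this, iP, iP', hQT, hTQ]
    noncomm_ring
  have b1 : ‖T * (P - P') * T‖ ≤ 2 * κ * ‖P - P'‖ := by rw [e1, norm_neg]; exact bound T nT
  have b2 : ‖Q * (P - P') * Q‖ ≤ 2 * κ * ‖P - P'‖ := by rw [e2]; exact bound Q nQ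
  have b3 : ‖Q * (P - P') * T‖ = ‖T * (P - P') * Q‖ := by
    rw [← norm_star]
    simp only [star_mul, star_sub, sT, sQ, sP, sP', mul_assoc]
  have dec : P - P' = T * (P - P') * T + T * (P - P') * Q + Q * (P - P') * T
      + Q * (P - P') * Q := by
    rw [hQ]; noncomm_ring
  refine ⟨b1, ?_⟩
  have h1 := norm_add_le (T * (P - P') * T + T * (P - P') * Q + Q * (P - P') * T)
    (Q * (P - P') * Q)
  have h2 := norm_add_le (T * (P - P') * T + T * (P - P') * Q) (Q * (P - P') * T)
  have h3 := norm_add_le (T * (P - P') * T) (T * (P - P') * Q)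
  rw [← dec] at h1
  linarith

theorem norm_coe_orthonormalBasis {F : Type*} [NormedAddCommGroup F] [InnerProductSpace ℝ F]
    {ι : Type*} [Fintype ι] {U : Submodule ℝ F} (g : OrthonormalBasis ι ℝ U) (k : ι) : ‖(g k : F)‖ = 1 := by
  rw [← Submodule.coe_norm, g.norm_eq_one]

theorem norm_starProjection_le_sum {ι : Type*} [Fintype ι] {U : Submodule ℝ F}
    (g : OrthonormalBasis ι ℝ U) (v : F) :
    ‖U.starProjection v‖ ≤ ∑ k, |inner ℝ (g k : F) v| := by
  rw [OrthonormalBasis.starProjection_eq_sum_rankOne g, sum_apply]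
  refine (norm_sum_le _ _).trans (Finset.sum_le_sum fun k _ => ?_)
  rw [InnerProductSpace.rankOne_apply, norm_smul, norm_coe_orthonormalBasis]
  simp

theorem norm_comp_starProjection_le_sum {ι : Type*} [Fintype ι] {U : Submodule ℝ F}
    (g : OrthonormalBasis ι ℝ U) (A : F →L[ℝ] F) :
    ‖A * U.starProjection‖ ≤ ∑ k, ‖A (g k : F)‖ := by
  refine ContinuousLinearMap.opNorm_le_bound _ (by positivity) fun v => ?_
  rw [mul_apply_eq_comp, OrthonormalBasis.starProjection_eq_sum_rankOne g,
    sum_apply, map_sum, Finset.sum_mul]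
  refine (norm_sum_le _ _).trans (Finset.sum_le_sum fun k _ => ?_)
  rw [InnerProductSpace.rankOne_apply, map_smul, norm_smul, mul_comm]
  gcongr
  have h := norm_inner_le_norm (𝕜 := ℝ) (g k : F) v
  rwa [norm_coe_orthonormalBasis, one_mul] at h

theorem exists_inner_ge_of_norm_starProjection_le {τ : Type*} [Fintype τ] {U : Submodule ℝ F}
    (f : OrthonormalBasis τ ℝ Uᗮ) {N : ℕ} (hτ : Fintype.card τ ≤ N)
    {e : F} (he : ‖e‖ = 1) (hU : ‖U.starProjection e‖ ≤ 1 / 2) :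
    ∃ i, 1 ≤ 2 * N * |inner ℝ (f i : F) e| := by
  by_contra! hcon
  have h1 : 1 / 2 ≤ ‖Uᗮ.starProjection e‖ := by
    have h2 : e = U.starProjection e + Uᗮ.starProjection e := by
      rw [Submodule.starProjection_orthogonal' U]; simp
    have h3 := norm_add_le (U.starProjection e) (Uᗮ.starProjection e)
    rw [← h2, he] at h3
    linarith
  have h2 := h1.trans (norm_starProjection_le_sum f e)
  have hne : Nonempty τ := by
    by_contra hemp
    rw [not_nonempty_iff] at hemp
    simp at h2
    linarith
  have hN : (0 : ℝ) < N := by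
    have : 0 < Fintype.card τ := Fintype.card_pos
    exact_mod_cast this.trans_le hτ
  have h3 : ∑ k, 2 * N * |inner ℝ (f k : F) e| < ∑ _k : τ, (1 : ℝ) :=
    Finset.sum_lt_sum_of_nonempty Finset.univ_nonempty fun k _ => hcon k
  rw [← Finset.mul_sum] at h3
  simp only [Finset.sum_const, Finset.card_univ, nsmul_eq_mul, mul_one] at h3
  have h4 : (Fintype.card τ : ℝ) ≤ N := by exact_mod_cast hτ
  nlinarith

/-- Near U a subspace is described by its off-diagonal block, with one vector of entries for each `f
j`. Near-orthogonality to `e` is a linear relation among these vectors in which the one of index `i`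
has a coefficient bounded below, so that one need not be prescribed. This lowers the parameter count
from m(n-m) to m(n-m-1). -/
theorem norm_starProjection_sub_le_of_entries {ι τ : Type*} [Fintype ι] [Fintype τ]
    {U V W : Submodule ℝ F} (g : OrthonormalBasis ι ℝ U) (f : OrthonormalBasis τ ℝ Uᗮ) {N : ℕ}
    (hN : 1 ≤ N) (hι : Fintype.card ι ≤ N) (hτ : Fintype.card τ ≤ N) {κ δ : ℝ} (hδ : 0 ≤ δ)
    (hκ : 24 * N * κ ≤ 1)
    (hV : ‖V.starProjection - U.starProjection‖ ≤ κ)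
    (hW : ‖W.starProjection - U.starProjection‖ ≤ κ)
    {e : F} (he : ‖e‖ = 1) (hVe : ‖V.starProjection e‖ ≤ δ) (hWe : ‖W.starProjection e‖ ≤ δ)
    {i : τ} (hi : 1 ≤ 2 * N * |inner ℝ (f i : F) e|)
    (hent : ∀ j, j ≠ i → ∀ k,
      |inner ℝ (g k : F) ((V.starProjection - W.starProjection) (f j : F))| ≤ δ) :
    ‖V.starProjection - W.starProjection‖ ≤ (12 * N ^ 3 + 16 * N) * δ := by
  classical
  obtain ⟨hTT, hoff⟩ := norm_starProjection_sub_le_offDiagonal U V W hV hW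
  set D := V.starProjection - W.starProjection with hD
  set T := U.starProjection with hT
  have hNR : (1 : ℝ) ≤ N := by exact_mod_cast hN
  have hιR : (Fintype.card ι : ℝ) ≤ N := by exact_mod_cast hι
  have hτR : (Fintype.card τ : ℝ) ≤ N := by exact_mod_cast hτ
  have hκ0 : 0 ≤ κ := (norm_nonneg _).trans hV
  set S := ∑ j ∈ Finset.univ.erase i, ‖(T * D) (f j : F)‖ with hSdef
  have hrow : ∀ j, j ≠ i → ‖(T * D) (f j : F)‖ ≤ N * δ := by
    intro j hj
    refine (norm_starProjection_le_sum g (D (f j : F))).trans ?_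
    calc ∑ k, |inner ℝ (g k : F) (D (f j : F))| ≤ ∑ _k : ι, δ :=
          Finset.sum_le_sum fun k _ => hent j hj k
      _ = Fintype.card ι * δ := by simp
      _ ≤ N * δ := by gcongr
  have hS : S ≤ N ^ 2 * δ := by
    calc S ≤ ∑ _j ∈ Finset.univ.erase i, (N * δ : ℝ) :=
          Finset.sum_le_sum fun j hj => hrow j (Finset.ne_of_mem_erase hj)
      _ ≤ ∑ _j : τ, (N * δ : ℝ) :=
          Finset.sum_le_sum_of_subset_of_nonneg (Finset.erase_subset _ _)
            fun _ _ _ => by positivity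
      _ = Fintype.card τ * (N * δ) := by simp
      _ ≤ N * (N * δ) := by gcongr
      _ = N ^ 2 * δ := by ring
  have hS0 : 0 ≤ S := Finset.sum_nonneg fun _ _ => norm_nonneg _
  have hsum : ‖T * D * Uᗮ.starProjection‖ ≤ ‖(T * D) (f i : F)‖ + S := by
    refine (norm_comp_starProjection_le_sum f (T * D)).trans_eq ?_
    rw [hSdef, Finset.add_sum_erase _ (fun j => ‖(T * D) (f j : F)‖) (Finset.mem_univ i)]
  have hDe : ‖D e‖ ≤ 2 * δ := by
    rw [hD, sub_apply]
    exact (norm_sub_le _ _).trans (by linarith)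
  have hexp : (T * D) e = (T * D * T) e + ∑ j, (inner ℝ (f j : F) e) • (T * D) (f j : F) := by
    have h2 : e = T e + Uᗮ.starProjection e := by
      rw [Submodule.starProjection_orthogonal' U]; simp [hT]
    conv_lhs => rw [h2]
    rw [map_add, OrthonormalBasis.starProjection_eq_sum_rankOne f, sum_apply,
      map_sum]
    simp [InnerProductSpace.rankOne_apply]
  -- Expand `(T * D) e` in the basis `f` and solve for the term of index `i`.
  have hrowi : |inner ℝ (f i : F) e| * ‖(T * D) (f i : F)‖ ≤ 2 * δ + 2 * κ * ‖D‖ + S := by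
    rw [← Real.norm_eq_abs, ← norm_smul]
    have h1 : (inner ℝ (f i : F) e) • (T * D) (f i : F) = (T * D) e - (T * D * T) e
        - ∑ j ∈ Finset.univ.erase i, (inner ℝ (f j : F) e) • (T * D) (f j : F) := by
      rw [hexp, ← Finset.add_sum_erase _ (fun j => (inner ℝ (f j : F) e) • (T * D) (f j : F))
        (Finset.mem_univ i)]
      abel
    rw [h1]
    refine (norm_sub_le _ _).trans (add_le_add ((norm_sub_le _ _).trans (add_le_add ?_ ?_)) ?_)
    · refine le_trans ?_ hDe
      rw [mul_apply_eq_comp]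
      exact U.norm_starProjection_apply_le _
    · refine (ContinuousLinearMap.le_opNorm _ _).trans ?_
      rw [he, mul_one]
      exact hTT
    · refine (norm_sum_le _ _).trans (Finset.sum_le_sum fun j _ => ?_)
      rw [norm_smul]
      have h := norm_inner_le_norm (𝕜 := ℝ) (f j : F) e
      rw [norm_coe_orthonormalBasis, he, one_mul] at h
      exact mul_le_of_le_one_left (norm_nonneg _) h
  have hi2 : ‖(T * D) (f i : F)‖ ≤ 2 * N * (2 * δ + 2 * κ * ‖D‖ + S) := by
    calc ‖(T * D) (f i : F)‖ ≤ (2 * N * |inner ℝ (f i : F) e|) * ‖(T * D) (f i : F)‖ :=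
          le_mul_of_one_le_left (norm_nonneg _) hi
      _ = 2 * N * (|inner ℝ (f i : F) e| * ‖(T * D) (f i : F)‖) := by ring
      _ ≤ _ := by gcongr
  have hDn := norm_nonneg D
  have k1 : κ * ‖D‖ ≤ N * κ * ‖D‖ := by
    have : 0 ≤ κ * ‖D‖ := by positivity
    nlinarith
  have k2 : 24 * N * κ * ‖D‖ ≤ ‖D‖ := mul_le_of_le_one_left hDn hκ
  have k3 : N * S ≤ N ^ 3 * δ := by
    calc N * S ≤ N * (N ^ 2 * δ) := by gcongr
      _ = N ^ 3 * δ := by ring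
  have k4 : S ≤ N * S := le_mul_of_one_le_left hS0 hNR
  -- The terms in ‖D‖ on the right have total coefficient 4κ + 8Nκ ≤ 12Nκ ≤ 1/2 and are absorbed on
  -- the left.
  nlinarith

end Projections

/-! ### Covering numbers of slabs in the Grassmannian. -/

theorem abs_sub_le_of_floor_div_eq {a b δ : ℝ} (hδ : 0 < δ) (h : ⌊a / δ⌋ = ⌊b / δ⌋) :
    |a - b| ≤ δ := by
  have h1 := (Int.abs_sub_lt_one_of_floor_eq_floor h).le
  rwa [← sub_div, abs_div, abs_of_pos hδ, div_le_one hδ] at h1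

/-- Subdivision of a set according to the cells of a grid of mesh `δ` for finitely many bounded
real coordinates. -/
theorem exists_finset_cells {α T : Type*} [Fintype T] (A : Set α) (y : α → T → ℝ)
    (hy : ∀ a t, |y a t| ≤ 1) {δ : ℝ} (hδ : 0 < δ) (hδ1 : δ ≤ 1) :
    ∃ 𝒜 : Finset (Set α), A ⊆ ⋃ C ∈ 𝒜, C ∧
      (∀ C ∈ 𝒜, ∀ a ∈ C, ∀ b ∈ C, a ∈ A ∧ b ∈ A ∧ ∀ t, |y a t - y b t| ≤ δ) ∧
      (𝒜.card : ℝ) ≤ (5 / δ) ^ Fintype.card T := by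
  classical
  set M : ℕ := ⌈1 / δ⌉₊ with hM
  have hM1 : 1 / δ ≤ M := Nat.le_ceil _
  set cells : Finset (T → ℤ) := Fintype.piFinset fun _ => Finset.Icc (-(M : ℤ)) M
  refine ⟨cells.image fun c => {a | a ∈ A ∧ ∀ t, ⌊y a t / δ⌋ = c t}, ?_, ?_, ?_⟩
  · intro a ha
    simp only [mem_iUnion, Finset.mem_image, exists_prop]
    refine ⟨_, ⟨fun t => ⌊y a t / δ⌋, ?_, rfl⟩, ha, fun t => rfl⟩
    refine Fintype.mem_piFinset.2 fun t => Finset.mem_Icc.2 ?_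
    have h1 := abs_le.1 (hy a t)
    constructor
    · refine Int.le_floor.2 ?_
      push_cast
      have h2 : -(1 / δ) ≤ y a t / δ := by
        rw [← neg_div]; gcongr; exact h1.1
      linarith
    · have h2 : y a t / δ ≤ M := le_trans (by gcongr; exact h1.2) hM1
      have h3 := (Int.floor_le (y a t / δ)).trans h2
      exact_mod_cast h3
  · intro C hC a ha b hb
    obtain ⟨c, -, rfl⟩ := Finset.mem_image.1 hC
    exact ⟨ha.1, hb.1, fun t => abs_sub_le_of_floor_div_eq hδ ((ha.2 t).trans (hb.2 t).symm)⟩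
  · have h1 : (Finset.Icc (-(M : ℤ)) M).card = 2 * M + 1 := by
      rw [Int.card_Icc]; omega
    have h2 : cells.card = (2 * M + 1) ^ Fintype.card T := by
      simp [cells, Fintype.card_piFinset, h1]
    -- Since δ ≤ 1, 2(1/δ + 1) + 1 ≤ 5/δ.
    have h3 : (2 * M + 1 : ℝ) ≤ 5 / δ := by
      have h4 := (Nat.ceil_lt_add_one (by positivity : 0 ≤ 1 / δ)).le
      have h5 : 1 ≤ 1 / δ := by rw [le_div_iff₀ hδ]; linarith
      have h6 : 5 / δ = 5 * (1 / δ) := by ring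
      rw [h6]
      linarith
    calc (((cells.image _).card : ℕ) : ℝ) ≤ (cells.card : ℝ) := by
          exact_mod_cast Finset.card_image_le
      _ = (2 * M + 1 : ℝ) ^ Fintype.card T := by rw [h2]; push_cast; ring
      _ ≤ _ := by gcongr

variable {n m : ℕ}

theorem Grassmannian.dist_eq (V W : Grassmannian n m) : dist V W = ‖V.proj - W.proj‖ :=
  dist_eq_norm V.proj W.proj

theorem Grassmannian.norm_proj_le (V : Grassmannian n m) : ‖V.proj‖ ≤ 1 :=
  V.1.starProjection_norm_le

theorem Grassmannian.norm_proj_apply_le (V : Grassmannian n m) (x : RSpace n) :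
    ‖V.proj x‖ ≤ ‖x‖ :=
  V.1.norm_starProjection_apply_le x

theorem Grassmannian.totallyBounded_univ : TotallyBounded (univ : Set (Grassmannian n m)) := by
  have hiso : Isometry (Grassmannian.proj : Grassmannian n m → _) := fun V W => rfl
  have h := totallyBounded_preimage hiso.isUniformInducing
    (isCompact_closedBall (0 : RSpace n →L[ℝ] RSpace n) 1).totallyBounded
  refine h.subset fun V _ => ?_
  simpa using V.norm_proj_le

/-- The grid is laid on the entries ⟨g_k, π_V f_j⟩ with j ≠ i. The omitted index i depends on V₀ and
e only, so the same coordinates serve the whole slab near V₀. -/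
theorem Grassmannian.exists_cells_of_near (hmn : m < n) {κ δ : ℝ}
    (hκ : 24 * n * κ ≤ 1) (hδ : 0 < δ) (hδκ : δ ≤ κ) (V₀ : Grassmannian n m)
    {e : RSpace n} (he : ‖e‖ = 1) :
    ∃ 𝒜 : Finset (Set (Grassmannian n m)),
      {V | V ∈ Metric.ball V₀ κ ∧ ‖V.proj e‖ ≤ δ} ⊆ ⋃ C ∈ 𝒜, C ∧
      (∀ C ∈ 𝒜, ∀ V ∈ C, ∀ W ∈ C, dist V W ≤ (12 * n ^ 3 + 16 * n) * δ) ∧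
      (𝒜.card : ℝ) ≤ (5 / δ) ^ (m * (n - m - 1)) := by
  classical
  have hn : 1 ≤ n := by omega
  have hnR : (1 : ℝ) ≤ n := by exact_mod_cast hn
  have hκ24 : κ ≤ 1 / 24 := by nlinarith
  set A : Set (Grassmannian n m) := {V | V ∈ Metric.ball V₀ κ ∧ ‖V.proj e‖ ≤ δ} with hA
  have hdist : ∀ V ∈ A, ‖V.1.starProjection - V₀.1.starProjection‖ ≤ κ := fun V hV => by
    have h := (Metric.mem_ball.1 hV.1).le
    rwa [Grassmannian.dist_eq] at h
  rcases A.eq_empty_or_nonempty with h0 | ⟨V₁, hV₁⟩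
  · exact ⟨∅, by simp [h0], by simp, by simp; positivity⟩
  have hfr := V₀.1.finrank_add_finrank_orthogonal
  rw [V₀.2, finrank_euclideanSpace_fin] at hfr
  set g := stdOrthonormalBasis ℝ V₀.1
  set f := stdOrthonormalBasis ℝ V₀.1ᗮ
  -- One member V₁ of the slab suffices: ‖π_{V₀} e‖ ≤ δ + κ ≤ 2κ ≤ 1/12.
  have hP₀e : ‖V₀.1.starProjection e‖ ≤ 1 / 2 := by
    have h1 : V₀.1.starProjection e = V₁.1.starProjection e
        - (V₁.1.starProjection - V₀.1.starProjection) e := by simp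
    have h2 := (V₁.1.starProjection - V₀.1.starProjection).le_opNorm e
    rw [he, mul_one] at h2
    rw [h1]
    have h3 := norm_sub_le (V₁.1.starProjection e)
      ((V₁.1.starProjection - V₀.1.starProjection) e)
    have h4 := hdist V₁ hV₁
    have h5 : ‖V₁.1.starProjection e‖ ≤ δ := hV₁.2
    linarith
  have hcf : Fintype.card (Fin (Module.finrank ℝ V₀.1ᗮ)) = n - m := by
    rw [Fintype.card_fin]; omega
  have hcg : Fintype.card (Fin (Module.finrank ℝ V₀.1)) = m := by
    rw [Fintype.card_fin, V₀.2]
  obtain ⟨i, hi⟩ := exists_inner_ge_of_norm_starProjection_le f (N := n) (by omega) he hP₀e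
  obtain ⟨𝒜, h1, h2, h3⟩ := exists_finset_cells
    (T := Fin (Module.finrank ℝ V₀.1) × {j // j ≠ i}) A
    (fun V t => inner ℝ (g t.1 : RSpace n) (V.proj (f t.2.1 : RSpace n)))
    (fun V t => by
      refine (abs_real_inner_le_norm _ _).trans ?_
      rw [norm_coe_orthonormalBasis, one_mul]
      exact (V.norm_proj_apply_le _).trans (norm_coe_orthonormalBasis _ _).le) hδ
    (by linarith)
  refine ⟨𝒜, h1, fun C hC V hV W hW => ?_, h3.trans_eq ?_⟩
  · obtain ⟨hVA, hWA, hent⟩ := h2 C hC V hV W hW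
    rw [Grassmannian.dist_eq]
    have hent' : ∀ j, j ≠ i → ∀ k, |inner ℝ (g k : RSpace n)
        ((V.1.starProjection - W.1.starProjection) (f j : RSpace n))| ≤ δ := fun j hj k => by
      have := hent (k, ⟨j, hj⟩)
      rwa [← inner_sub_right] at this
    exact norm_starProjection_sub_le_of_entries (U := V₀.1) (V := V.1) (W := W.1) g f hn
      (hcg.trans_le hmn.le) (hcf.trans_le (Nat.sub_le n m)) hδ.le hκ
      (hdist V hVA) (hdist W hWA) he hVA.2 hWA.2 hi hent'
  · rw [Fintype.card_prod, hcg, Fintype.card_subtype_compl, hcf]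
    simp

/-- The subspaces almost orthogonal to a given vector have the covering numbers of a set of
dimension `m (n - m - 1)`. -/
theorem Grassmannian.exists_cells_slab (hmn : m < n) :
    ∃ K : ℝ, 1 ≤ K ∧ ∀ (x : RSpace n) (δ : ℝ), x ≠ 0 → 0 < δ → δ ≤ 2 →
      ∃ 𝒜 : Finset (Set (Grassmannian n m)),
        {V | ‖V.proj x‖ ≤ δ * ‖x‖} ⊆ ⋃ C ∈ 𝒜, C ∧
        (∀ C ∈ 𝒜, ∀ V ∈ C, ∀ W ∈ C, dist V W ≤ K * δ) ∧
        (𝒜.card : ℝ) ≤ K * (1 / δ) ^ (m * (n - m - 1)) := by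
  classical
  have hn : (0 : ℝ) < n := by exact_mod_cast (by omega : 0 < n)
  set κ : ℝ := 1 / (24 * n) with hκdef
  have hκ : 0 < κ := by positivity
  obtain ⟨t, -, htf, ht⟩ := Metric.finite_approx_of_totallyBounded
    (Grassmannian.totallyBounded_univ (n := n) (m := m)) κ hκ
  set p := m * (n - m - 1)
  set t' := htf.toFinset
  set K₁ : ℝ := 12 * n ^ 3 + 16 * n
  have hK₁ : 0 ≤ K₁ := by positivity
  -- `K₁` and `5 ^ p` serve δ ≤ κ. For κ < δ ≤ 2 the whole Grassmannian is covered by κ-balls: their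
  -- diameter is at most 2κ ≤ 2δ, and `2 ^ p` compensates (1/δ)^p, which may be less than 1.
  refine ⟨1 + K₁ + 2 + t'.card * (5 ^ p + 2 ^ p), ?_, ?_⟩
  · have : 0 ≤ t'.card * ((5 : ℝ) ^ p + 2 ^ p) := by positivity
    linarith
  intro x δ hx hδ hδ2
  have hxn : 0 < ‖x‖ := norm_pos_iff.2 hx
  have hcard0 : 0 ≤ t'.card * ((5 : ℝ) ^ p + 2 ^ p) := by positivity
  rcases le_or_gt δ κ with hδκ | hδκ
  · set e : RSpace n := ‖x‖⁻¹ • x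
    have he : ‖e‖ = 1 := by simp [e, norm_smul, hxn.ne']
    have hpe : ∀ V : Grassmannian n m, ‖V.proj x‖ ≤ δ * ‖x‖ → ‖V.proj e‖ ≤ δ := fun V hV => by
      rw [map_smul, norm_smul, norm_inv, norm_norm, inv_mul_le_iff₀ hxn, mul_comm]
      exact hV
    choose 𝒜 h1 h2 h3 using fun V₀ : Grassmannian n m =>
      Grassmannian.exists_cells_of_near hmn (κ := κ) (δ := δ)
        (by rw [hκdef, mul_one_div_cancel (by positivity)]) hδ hδκ V₀ he
    refine ⟨t'.biUnion 𝒜, ?_, ?_, ?_⟩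
    · intro V hV
      obtain ⟨V₀, hV₀, hVV₀⟩ := mem_iUnion₂.1 (ht (mem_univ V))
      obtain ⟨C, hC, hVC⟩ := mem_iUnion₂.1 (h1 V₀ ⟨hVV₀, hpe V hV⟩)
      exact mem_iUnion₂.2 ⟨C, Finset.mem_biUnion.2 ⟨V₀, htf.mem_toFinset.2 hV₀, hC⟩, hVC⟩
    · intro C hC V hV W hW
      obtain ⟨V₀, -, hC'⟩ := Finset.mem_biUnion.1 hC
      exact (h2 V₀ C hC' V hV W hW).trans
        (mul_le_mul_of_nonneg_right (by change K₁ ≤ _; linarith) hδ.le)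
    · calc ((t'.biUnion 𝒜).card : ℝ) ≤ ∑ V₀ ∈ t', ((𝒜 V₀).card : ℝ) := by
            exact_mod_cast Finset.card_biUnion_le
        _ ≤ ∑ _V₀ ∈ t', (5 / δ) ^ p := Finset.sum_le_sum fun V₀ _ => h3 V₀
        _ = t'.card * 5 ^ p * (1 / δ) ^ p := by
            rw [Finset.sum_const, nsmul_eq_mul, mul_assoc, ← mul_pow]; ring
        _ ≤ _ := by
            gcongr
            have : 0 ≤ (t'.card : ℝ) * 2 ^ p := by positivity
            linarith
  · refine ⟨t'.image fun V₀ => Metric.ball V₀ κ, ?_, ?_, ?_⟩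
    · intro V _
      obtain ⟨V₀, hV₀, hVV₀⟩ := mem_iUnion₂.1 (ht (mem_univ V))
      exact mem_iUnion₂.2 ⟨_, Finset.mem_image_of_mem _ (htf.mem_toFinset.2 hV₀), hVV₀⟩
    · intro C hC V hV W hW
      obtain ⟨V₀, -, rfl⟩ := Finset.mem_image.1 hC
      have h1 := dist_triangle_right V W V₀
      have h2 := Metric.mem_ball.1 hV
      have h3 := Metric.mem_ball.1 hW
      have h4 : 0 ≤ (1 + K₁ + t'.card * ((5 : ℝ) ^ p + 2 ^ p)) * δ := by positivity
      nlinarith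
    · calc (((t'.image _).card : ℕ) : ℝ) ≤ t'.card := by exact_mod_cast Finset.card_image_le
        _ ≤ t'.card * 2 ^ p * (1 / δ) ^ p := by
            rw [mul_assoc, ← mul_pow]
            refine le_mul_of_one_le_right (by positivity) (one_le_pow₀ ?_)
            rw [mul_one_div, le_div_iff₀ hδ]
            linarith
        _ ≤ _ := by
            gcongr
            have : 0 ≤ (t'.card : ℝ) * 5 ^ p := by positivity
            linarith

/-! ### A finite Frostman lemma. -/

/-- Maximal weights subject to finitely many constraints: every point meets a constraint that
is attained. -/
theorem exists_weights_tight {α ι : Type*} [DecidableEq α] (I : Finset ι) (S : ι → Finset α)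
    (c : ι → ℝ) (hc : ∀ i ∈ I, 0 ≤ c i) (N : Finset α) (hN : ∀ y ∈ N, ∃ i ∈ I, y ∈ S i) :
    ∃ w : α → ℝ, (∀ y, 0 ≤ w y) ∧ (∀ i ∈ I, ∑ y ∈ S i, w y ≤ c i) ∧
      ∀ y ∈ N, ∃ i ∈ I, y ∈ S i ∧ ∑ y ∈ S i, w y = c i := by
  induction N using Finset.induction_on with
  | empty => exact ⟨fun _ => 0, by simp, by simpa using hc, by simp⟩
  | insert a N _ ih =>
    obtain ⟨w, hw0, hw1, hw2⟩ := ih fun y hy => hN y (Finset.mem_insert_of_mem hy)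
    obtain ⟨i₀, hi₀, hai₀⟩ := hN a (Finset.mem_insert_self a N)
    obtain ⟨i₁, hi₁, hmin⟩ := Finset.exists_min_image (I.filter fun i => a ∈ S i)
      (fun i => c i - ∑ y ∈ S i, w y) ⟨i₀, Finset.mem_filter.2 ⟨hi₀, hai₀⟩⟩
    obtain ⟨hi₁I, hai₁⟩ := Finset.mem_filter.1 hi₁
    -- The smallest slack among the constraints containing `a`: raising `w a` by it makes `i₁` tight
    -- and violates none. Constraints already tight stay tight, since weights only grow.
    set τ := c i₁ - ∑ y ∈ S i₁, w y with hτ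
    have hτ0 : 0 ≤ τ := sub_nonneg.2 (hw1 i₁ hi₁I)
    have hsum : ∀ i, ∑ y ∈ S i, (w y + if y = a then τ else 0) =
        ∑ y ∈ S i, w y + if a ∈ S i then τ else 0 := fun i => by
      rw [Finset.sum_add_distrib, Finset.sum_ite_eq']
    have hle : ∀ i ∈ I, ∑ y ∈ S i, (w y + if y = a then τ else 0) ≤ c i := fun i hi => by
      rw [hsum]
      split_ifs with h
      · have := hmin i (Finset.mem_filter.2 ⟨hi, h⟩)
        linarith
      · simpa using hw1 i hi
    refine ⟨fun y => w y + if y = a then τ else 0, fun y => ?_, hle, fun y hy => ?_⟩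
    · have := hw0 y
      simp only
      split_ifs <;> linarith
    · rcases Finset.mem_insert.1 hy with rfl | hy
      · refine ⟨i₁, hi₁I, hai₁, ?_⟩
        rw [hsum, if_pos hai₁]
        linarith
      · obtain ⟨i, hi, hyi, heq⟩ := hw2 y hy
        refine ⟨i, hi, hyi, le_antisymm (hle i hi) ?_⟩
        rw [hsum, ← heq]
        split_ifs <;> linarith

/-- A finite version of Frostman's lemma. -/
theorem exists_finset_frostman {X : Type*} [MetricSpace X] (N : Finset X) {ρ₀ d : ℝ}
    (hρ : 0 < ρ₀) (hd : 0 ≤ d) :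
    ∃ (w : X → ℝ) (u : Finset (X × ℝ)), (∀ x, 0 ≤ w x) ∧
      (∀ x ∈ N, ∀ ρ, ρ₀ ≤ ρ → ∑ y ∈ N with dist y x ≤ ρ, w y ≤ ρ ^ d) ∧
      (∀ b ∈ u, ρ₀ ≤ b.2) ∧ (∀ y ∈ N, ∃ b ∈ u, dist y b.1 ≤ 5 * b.2) ∧
      ∑ b ∈ u, b.2 ^ d ≤ ∑ y ∈ N, w y := by
  classical
  -- The mass of a ball centred in `N` changes only at mutual distances of points of `N`, so
  -- finitely many radii imply the bound for all radii at least `ρ₀`.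
  set rad : Finset ℝ :=
    insert ρ₀ (((N ×ˢ N).image fun p => dist p.1 p.2).filter fun r => ρ₀ ≤ r) with hrad
  have hradle : ∀ r ∈ rad, ρ₀ ≤ r := fun r hr => by
    rcases Finset.mem_insert.1 hr with rfl | hr
    · exact le_rfl
    · exact (Finset.mem_filter.1 hr).2
  set S : X × ℝ → Finset X := fun b => N.filter fun y => dist y b.1 ≤ b.2 with hS
  obtain ⟨w, hw0, hw1, hw2⟩ := exists_weights_tight (N ×ˢ rad) S (fun b => b.2 ^ d)
    (fun b hb => Real.rpow_nonneg (hρ.le.trans (hradle _ (Finset.mem_product.1 hb).2)) _) N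
    (fun y hy => ⟨(y, ρ₀), Finset.mem_product.2 ⟨hy, Finset.mem_insert_self _ _⟩,
      Finset.mem_filter.2 ⟨hy, by simpa using hρ.le⟩⟩)
  set t : Set (X × ℝ) := {b | b ∈ N ×ˢ rad ∧ ∑ y ∈ S b, w y = b.2 ^ d}
  obtain ⟨R, hR⟩ := rad.exists_le
  -- The tight balls contain every point of `N`. A disjoint subfamily still covers after enlargement
  -- by 5, and by tightness and disjointness its sum of `b.2 ^ d` is the mass of its union.
  obtain ⟨u, hut, hdisj, hcov⟩ := Vitali.exists_disjoint_subfamily_covering_enlargement_closedBall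
    t (fun b => b.1) (fun b => b.2) R (fun b hb => hR _ (Finset.mem_product.1 hb.1).2) 5
    (by norm_num)
  have htf : t.Finite := (N ×ˢ rad).finite_toSet.subset fun b hb => hb.1
  have huf : u.Finite := htf.subset hut
  have hmem : ∀ b ∈ huf.toFinset, b ∈ t := fun b hb => hut (huf.mem_toFinset.1 hb)
  refine ⟨w, huf.toFinset, hw0, fun x hx ρ hρρ => ?_, fun b hb =>
    hradle _ (Finset.mem_product.1 (hmem b hb).1).2, fun y hy => ?_, ?_⟩
  · obtain ⟨r, hr, hmax⟩ := Finset.exists_max_image (rad.filter fun r => r ≤ ρ) id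
      ⟨ρ₀, Finset.mem_filter.2 ⟨Finset.mem_insert_self _ _, hρρ⟩⟩
    obtain ⟨hrr, hrρ⟩ := Finset.mem_filter.1 hr
    calc ∑ y ∈ N with dist y x ≤ ρ, w y ≤ ∑ y ∈ S (x, r), w y := by
          refine Finset.sum_le_sum_of_subset_of_nonneg (fun y hy => ?_) fun y _ _ => hw0 y
          obtain ⟨hyN, hyρ⟩ := Finset.mem_filter.1 hy
          refine Finset.mem_filter.2 ⟨hyN, ?_⟩
          rcases le_total ρ₀ (dist y x) with h | h
          · refine hmax _ (Finset.mem_filter.2 ⟨Finset.mem_insert_of_mem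
              (Finset.mem_filter.2 ⟨Finset.mem_image.2 ⟨(y, x), ?_, rfl⟩, h⟩), hyρ⟩)
            exact Finset.mem_product.2 ⟨hyN, hx⟩
          · exact h.trans (hradle r hrr)
      _ ≤ r ^ d := hw1 (x, r) (Finset.mem_product.2 ⟨hx, hrr⟩)
      _ ≤ ρ ^ d := Real.rpow_le_rpow (hρ.le.trans (hradle r hrr)) hrρ hd
  · obtain ⟨b, hb, hyb, heq⟩ := hw2 y hy
    obtain ⟨b', hb', hsub⟩ := hcov b ⟨hb, heq⟩
    exact ⟨b', huf.mem_toFinset.2 hb', hsub (Finset.mem_filter.1 hyb).2⟩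
  · calc ∑ b ∈ huf.toFinset, b.2 ^ d = ∑ b ∈ huf.toFinset, ∑ y ∈ S b, w y :=
          Finset.sum_congr rfl fun b hb => (hmem b hb).2.symm
      _ = ∑ y ∈ huf.toFinset.biUnion S, w y := by
          refine (Finset.sum_biUnion fun b hb b' hb' hne => ?_).symm
          refine Finset.disjoint_left.2 fun y hy hy' => ?_
          exact Set.disjoint_left.1 (hdisj (huf.mem_toFinset.1 hb) (huf.mem_toFinset.1 hb') hne)
            (Finset.mem_filter.1 hy).2 (Finset.mem_filter.1 hy').2
      _ ≤ ∑ y ∈ N, w y := by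
          refine Finset.sum_le_sum_of_subset_of_nonneg ?_ fun y _ _ => hw0 y
          exact Finset.biUnion_subset.2 fun b _ => Finset.filter_subset _ _

/-! ### Ball covers and Hausdorff dimension. -/

/-- `A` is covered by finitely many balls whose radii satisfy `∑ ρ ^ d ≤ η`. -/
def HasBallCover {X : Type*} [MetricSpace X] (A : Set X) (d η : ℝ) : Prop :=
  ∃ u : Finset (X × ℝ), (∀ b ∈ u, 0 ≤ b.2) ∧ A ⊆ ⋃ b ∈ u, Metric.closedBall b.1 b.2 ∧
    ∑ b ∈ u, b.2 ^ d ≤ η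

/-- For a totally bounded set, a bound for all discrete Frostman measures on it gives an
efficient cover. -/
theorem hasBallCover_of_frostman_bound {X : Type*} [MetricSpace X] {A : Set X}
    (hA : TotallyBounded A) {ρ₀ d η : ℝ} (hρ : 0 < ρ₀) (hd : 0 ≤ d)
    (h : ∀ (N : Finset X) (w : X → ℝ), (N : Set X) ⊆ A → (∀ x, 0 ≤ w x) →
      (∀ x ∈ N, ∀ ρ, ρ₀ ≤ ρ → ∑ y ∈ N with dist y x ≤ ρ, w y ≤ ρ ^ d) → ∑ y ∈ N, w y ≤ η) :
    HasBallCover A d (6 ^ d * η) := by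
  classical
  obtain ⟨t, htA, htf, ht⟩ := Metric.finite_approx_of_totallyBounded hA ρ₀ hρ
  obtain ⟨w, u, hw0, hw1, hu0, hucov, hsum⟩ := exists_finset_frostman htf.toFinset hρ hd
  have hη := h htf.toFinset w (by simpa using htA) hw0 hw1
  -- Factor 5 from Vitali, plus one more radius to pass from the `ρ₀`-net to `A`, as every radius is
  -- at least `ρ₀`.
  refine ⟨u.image fun b => (b.1, 6 * b.2), ?_, fun x hx => ?_, ?_⟩
  · intro b hb
    obtain ⟨b, hb', rfl⟩ := Finset.mem_image.1 hb
    have := hu0 b hb'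
    simp only
    linarith
  · obtain ⟨y, hy, hxy⟩ := mem_iUnion₂.1 (ht hx)
    obtain ⟨b, hb, hyb⟩ := hucov y (htf.mem_toFinset.2 hy)
    refine mem_iUnion₂.2 ⟨_, Finset.mem_image_of_mem _ hb, Metric.mem_closedBall.2 ?_⟩
    have h1 := dist_triangle x y b.1
    have h2 := Metric.mem_ball.1 hxy
    have h3 := hu0 b hb
    simp only
    linarith
  · have hinj : Function.Injective fun b : X × ℝ => (b.1, 6 * b.2) := fun b b' hbb => by
      simp only [Prod.mk.injEq] at hbb
      exact Prod.ext hbb.1 (by linarith [hbb.2])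
    rw [Finset.sum_image fun _ _ _ _ h => hinj h]
    calc ∑ b ∈ u, (6 * b.2) ^ d = ∑ b ∈ u, 6 ^ d * b.2 ^ d :=
          Finset.sum_congr rfl fun b hb =>
            Real.mul_rpow (by norm_num) (hρ.le.trans (hu0 b hb))
      _ = 6 ^ d * ∑ b ∈ u, b.2 ^ d := by rw [Finset.mul_sum]
      _ ≤ _ := by gcongr; exact hsum.trans hη

/-- A convergence (Borel-Cantelli) criterion for the Hausdorff dimension of an upper limit. -/
theorem dimH_le_of_frequently_mem {X : Type*} [MetricSpace X] {S : Set X} {A : ℕ → Set X}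
    {d : ℝ} (hd : 0 < d) {a : ℕ → ℝ} (ha0 : ∀ k, 0 ≤ a k) (ha : Summable a)
    (hA : ∀ k, HasBallCover (A k) d (a k)) (hS : ∀ x ∈ S, ∃ᶠ k in atTop, x ∈ A k) :
    dimH S ≤ ENNReal.ofReal d := by
  borelize X
  choose u hu0 hucov hsum using hA
  set f : ℕ → ℝ≥0∞ := fun k => ENNReal.ofReal (a k) with hf
  set T : ℕ → ℝ≥0∞ := fun K => ∑' k, f (k + K) with hT
  have hfsum : ∑' k, f k ≠ ⊤ := by
    rw [hf, ← ENNReal.ofReal_tsum_of_nonneg ha0 ha]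
    exact ENNReal.ofReal_ne_top
  have hT0 : Tendsto T atTop (𝓝 0) := ENNReal.tendsto_sum_nat_add f hfsum
  have hsum' : ∀ k, ∑ b ∈ u k, ENNReal.ofReal b.2 ^ d ≤ f k := fun k => by
    calc ∑ b ∈ u k, ENNReal.ofReal b.2 ^ d = ∑ b ∈ u k, ENNReal.ofReal (b.2 ^ d) :=
          Finset.sum_congr rfl fun b hb => ENNReal.ofReal_rpow_of_nonneg (hu0 k b hb) hd.le
      _ = ENNReal.ofReal (∑ b ∈ u k, b.2 ^ d) :=
          (ENNReal.ofReal_sum_of_nonneg fun b hb => Real.rpow_nonneg (hu0 k b hb) _).symm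
      _ ≤ f k := ENNReal.ofReal_le_ofReal (hsum k)
  have hediam : ∀ (x : X) (r : ℝ), 0 ≤ r → Metric.ediam (Metric.closedBall x r) ≤ 2 * ENNReal.ofReal r :=
    fun x r hr => by
      rw [← Metric.closedEBall_ofReal hr]
      exact Metric.ediam_closedEBall_le
  have hμ : μH[d] S = 0 := by
    refine le_antisymm ?_ (zero_le)
    -- The covers from index `K` onwards form one cover of `S`. Each ball has ρ^d at most the tail
    -- `T K`, hence diameter at most 2 (T K)^(1/d), which tends to 0.
    have key := Measure.hausdorffMeasure_le_liminf_tsum (X := X) (β := ℕ)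
      (ι := fun K => Σ k : ℕ, {b // b ∈ u (k + K)}) d S (l := atTop)
      (fun K => 2 * T K ^ (1 / d)) ?_
      (fun K i => Metric.closedBall i.2.1.1 i.2.1.2) (Eventually.of_forall fun K i => ?_)
      (Eventually.of_forall fun K x hx => ?_)
    · refine key.trans ?_
      have hlim : Tendsto (fun K => 2 ^ d * T K) atTop (𝓝 0) := by
        have := ENNReal.Tendsto.const_mul (a := 2 ^ d) hT0
          (Or.inr (ENNReal.rpow_ne_top_of_nonneg hd.le (by simp)))
        simpa using this
      rw [← hlim.liminf_eq]
      refine liminf_le_liminf (Eventually.of_forall fun K => ?_)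
      rw [ENNReal.tsum_sigma', hT, ← ENNReal.tsum_mul_left]
      refine ENNReal.tsum_le_tsum fun k => ?_
      rw [tsum_fintype]
      calc ∑ b : {b // b ∈ u (k + K)}, Metric.ediam (Metric.closedBall b.1.1 b.1.2) ^ d
          ≤ ∑ b : {b // b ∈ u (k + K)}, 2 ^ d * ENNReal.ofReal b.1.2 ^ d := by
            refine Finset.sum_le_sum fun b _ => ?_
            rw [← ENNReal.mul_rpow_of_nonneg _ _ hd.le]
            exact ENNReal.rpow_le_rpow (hediam _ _ (hu0 _ _ b.2)) hd.le
        _ = 2 ^ d * ∑ b ∈ u (k + K), ENNReal.ofReal b.2 ^ d := by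
            rw [← Finset.mul_sum, Finset.sum_coe_sort (u (k + K))
              fun b => ENNReal.ofReal b.2 ^ d]
        _ ≤ _ := by gcongr; exact hsum' _
    · have h1 : Tendsto (fun K => T K ^ (1 / d)) atTop (𝓝 0) := by
        have := ((ENNReal.continuous_rpow_const (y := 1 / d)).tendsto 0).comp hT0
        rwa [ENNReal.zero_rpow_of_pos (by positivity)] at this
      simpa using ENNReal.Tendsto.const_mul (a := 2) h1 (Or.inr (by simp))
    · refine (hediam _ _ (hu0 _ _ i.2.2)).trans ?_
      gcongr
      rw [one_div, ENNReal.le_rpow_inv_iff hd]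
      calc ENNReal.ofReal i.2.1.2 ^ d ≤ ∑ b ∈ u (i.1 + K), ENNReal.ofReal b.2 ^ d :=
            Finset.single_le_sum (f := fun b : X × ℝ => ENNReal.ofReal b.2 ^ d)
              (fun _ _ => zero_le) i.2.2
        _ ≤ f (i.1 + K) := hsum' _
        _ ≤ T K := ENNReal.le_tsum i.1
    · obtain ⟨k, hk, hxk⟩ := (frequently_atTop.1 (hS x hx)) K
      obtain ⟨b, hb, hxb⟩ := mem_iUnion₂.1 (hucov k hxk)
      obtain ⟨j, rfl⟩ := Nat.exists_eq_add_of_le' hk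
      exact mem_iUnion.2 ⟨⟨j, b, hb⟩, hxb⟩
  have h2 : (ENNReal.ofReal d) = ((d.toNNReal : ℝ≥0) : ℝ≥0∞) := rfl
  rw [h2]
  refine dimH_le_of_hausdorffMeasure_ne_top ?_
  rw [Real.coe_toNNReal _ hd.le, hμ]
  simp

/-! ### The radial kernel. -/

/-- The kernel as a function of the norm. -/
noncomputable def radialKernel (r θ s t u : ℝ) : ℝ :=
  if u < r then 1
  else if u < r ^ θ then (r / u) ^ s
  else r ^ (θ * (t - s) + s) / u ^ t

theorem kernel_eq_radialKernel {n : ℕ} (r θ s t : ℝ) (x : RSpace n) :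
    kernel r θ s t x = radialKernel r θ s t ‖x‖ := rfl

section Radial

variable {r θ s t u v : ℝ}

theorem le_rpow_self_of_le_one (hr : 0 < r) (hr1 : r < 1) (hθ1 : θ ≤ 1) : r ≤ r ^ θ := by
  simpa using Real.rpow_le_rpow_of_exponent_ge hr hr1.le hθ1

/-- The product form shows monotonicity in the distance and in the exponents without further case
distinctions. -/
theorem radialKernel_eq_mul (hr : 0 < r) (hr1 : r < 1) (hθ1 : θ ≤ 1) (hu : 0 < u) :
    radialKernel r θ s t u = min 1 (r / u) ^ s * min 1 (r ^ θ / u) ^ (t - s) := by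
  have hrθ := le_rpow_self_of_le_one hr hr1 hθ1
  have hp : 0 < r ^ θ := by positivity
  unfold radialKernel
  split_ifs with h1 h2
  · rw [min_eq_left ((one_le_div hu).2 h1.le), min_eq_left ((one_le_div hu).2 (h1.le.trans hrθ))]
    simp
  · rw [min_eq_right ((div_le_one hu).2 (not_lt.1 h1)), min_eq_left ((one_le_div hu).2 h2.le)]
    simp
  · rw [min_eq_right ((div_le_one hu).2 (not_lt.1 h1)),
      min_eq_right ((div_le_one hu).2 (not_lt.1 h2)), Real.div_rpow hr.le hu.le,
      Real.div_rpow hp.le hu.le, ← Real.rpow_mul hr.le, div_mul_div_comm, ← Real.rpow_add hr,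
      ← Real.rpow_add hu]
    congr 2 <;> ring

theorem radialKernel_nonneg (hr : 0 < r) (hr1 : r < 1) (hθ1 : θ ≤ 1) (hu : 0 < u) :
    0 ≤ radialKernel r θ s t u := by
  rw [radialKernel_eq_mul hr hr1 hθ1 hu]
  positivity

theorem radialKernel_self (hr : 0 < r) (hr1 : r < 1) (hθ1 : θ ≤ 1) :
    radialKernel r θ s t r = 1 := by
  rw [radialKernel_eq_mul hr hr1 hθ1 hr, div_self hr.ne',
    min_eq_left ((one_le_div hr).2 (le_rpow_self_of_le_one hr hr1 hθ1))]
  simp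

theorem radialKernel_antitone (hr : 0 < r) (hr1 : r < 1) (hθ1 : θ ≤ 1) (hs : 0 ≤ s)
    (hst : s ≤ t) (hu : 0 < u) (huv : u ≤ v) :
    radialKernel r θ s t v ≤ radialKernel r θ s t u := by
  have hv := hu.trans_le huv
  rw [radialKernel_eq_mul hr hr1 hθ1 hu, radialKernel_eq_mul hr hr1 hθ1 hv]
  have hst' : 0 ≤ t - s := sub_nonneg.2 hst
  gcongr

theorem radialKernel_anti_exponent {t' : ℝ} (hr : 0 < r) (hr1 : r < 1) (hθ1 : θ ≤ 1)
    (htt : t ≤ t') (hu : 0 < u) : radialKernel r θ s t' u ≤ radialKernel r θ s t u := by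
  rw [radialKernel_eq_mul hr hr1 hθ1 hu, radialKernel_eq_mul hr hr1 hθ1 hu]
  have hp : 0 < r ^ θ := by positivity
  gcongr ?_ * ?_
  exact Real.rpow_le_rpow_of_exponent_ge (by positivity) (min_le_left _ _) (by linarith)

theorem rpow_mul_radialKernel (hr : 0 < r) (hr1 : r < 1) (hθ1 : θ ≤ 1) (hu : 0 < u) :
    u ^ t * radialKernel r θ s t u = min u r ^ s * min u (r ^ θ) ^ (t - s) := by
  have hp : 0 < r ^ θ := by positivity
  have hmin : ∀ a : ℝ, min u a = u * min 1 (a / u) := fun a => by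
    rw [mul_min_of_nonneg _ _ hu.le, mul_one, mul_div_cancel₀ _ hu.ne']
  rw [radialKernel_eq_mul hr hr1 hθ1 hu, hmin r, hmin (r ^ θ),
    Real.mul_rpow hu.le (by positivity), Real.mul_rpow hu.le (by positivity)]
  have : u ^ t = u ^ s * u ^ (t - s) := by rw [← Real.rpow_add hu]; congr 1; ring
  rw [this]
  ring

theorem rpow_mul_radialKernel_mono (hr : 0 < r) (hr1 : r < 1) (hθ1 : θ ≤ 1) (hs : 0 ≤ s)
    (hst : s ≤ t) (hu : 0 < u) (huv : u ≤ v) :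
    u ^ t * radialKernel r θ s t u ≤ v ^ t * radialKernel r θ s t v := by
  have hv := hu.trans_le huv
  rw [rpow_mul_radialKernel hr hr1 hθ1 hu, rpow_mul_radialKernel hr hr1 hθ1 hv]
  have hst' : 0 ≤ t - s := sub_nonneg.2 hst
  have hp : 0 < r ^ θ := by positivity
  gcongr

/-- The kernel of exponent t decays no faster than u^(-t). In the average over V, with t' = m and t
= λ, this bounds one dyadic layer: the kernel at height u times the mass (u/v)^λ of the slab. -/
theorem radialKernel_mul_div_rpow_le {t' : ℝ} (hr : 0 < r) (hr1 : r < 1) (hθ1 : θ ≤ 1)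
    (hs : 0 ≤ s) (hst : s ≤ t) (htt : t ≤ t') (hu : 0 < u) (huv : u ≤ v) :
    radialKernel r θ s t' u * (u / v) ^ t ≤ radialKernel r θ s t v := by
  have hv := hu.trans_le huv
  rw [Real.div_rpow hu.le hv.le, ← mul_div_assoc, div_le_iff₀ (by positivity),
    mul_comm _ (u ^ t), mul_comm _ (v ^ t)]
  refine le_trans ?_ (rpow_mul_radialKernel_mono hr hr1 hθ1 hs hst hu huv)
  gcongr
  exact radialKernel_anti_exponent hr hr1 hθ1 htt hu

theorem radialKernel_lower (hr : 0 < r) (hr1 : r < 1) (hθ1 : θ ≤ 1) (hs : 0 ≤ s)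
    (hst : s ≤ t) (hu : r ≤ u) (hu2 : u ≤ 2 * r ^ θ) :
    2 ^ (-t) * (r / u) ^ s ≤ radialKernel r θ s t u := by
  have hu0 := hr.trans_le hu
  have hp : 0 < r ^ θ := by positivity
  rw [radialKernel_eq_mul hr hr1 hθ1 hu0, min_eq_right ((div_le_one hu0).2 hu), mul_comm]
  gcongr
  have h1 : (1 / 2 : ℝ) ≤ min 1 (r ^ θ / u) :=
    le_min (by norm_num) (by rw [div_le_div_iff₀ (by norm_num) hu0]; linarith)
  calc (2 : ℝ) ^ (-t) = (1 / 2) ^ t := by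
        rw [Real.rpow_neg (by norm_num), one_div, Real.inv_rpow (by norm_num)]
    _ ≤ (1 / 2) ^ (t - s) :=
        Real.rpow_le_rpow_of_exponent_ge (by norm_num) (by norm_num) (by linarith)
    _ ≤ _ := Real.rpow_le_rpow (by norm_num) h1 (sub_nonneg.2 hst)

/-- Decomposition of the kernel into dyadic layers. -/
theorem radialKernel_le_sum_layers {X : ℝ} (hr : 0 < r) (hr1 : r < 1) (hθ1 : θ ≤ 1) (hs : 0 ≤ s)
    (hst : s ≤ t) (huX : u ≤ X) (hrX : r ≤ X) {J : ℕ} (hJ : X ≤ 2 ^ J * r) :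
    radialKernel r θ s t u ≤ ∑ j ∈ Finset.range (J + 1) with 2 ^ j * r ≤ X,
      radialKernel r θ s t (2 ^ j * r) * if u ≤ 2 * (2 ^ j * r) then 1 else 0 := by
  have hterm : ∀ j : ℕ, 0 ≤ radialKernel r θ s t (2 ^ j * r) *
      if u ≤ 2 * (2 ^ j * r) then (1 : ℝ) else 0 := fun j =>
    mul_nonneg (radialKernel_nonneg hr hr1 hθ1 (by positivity)) (by split_ifs <;> norm_num)
  suffices h : ∃ j : ℕ, 2 ^ j * r ≤ X ∧ u ≤ 2 * (2 ^ j * r) ∧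
      radialKernel r θ s t u ≤ radialKernel r θ s t (2 ^ j * r) by
    obtain ⟨j, h1, h2, h3⟩ := h
    have hjJ : j ≤ J := by
      have := le_of_mul_le_mul_right (h1.trans hJ) hr
      exact (pow_le_pow_iff_right₀ (by norm_num)).1 this
    refine le_trans ?_ (Finset.single_le_sum (fun j _ => hterm j)
      (Finset.mem_filter.2 ⟨Finset.mem_range.2 (Nat.lt_succ_of_le hjJ), h1⟩))
    rw [if_pos h2, mul_one]
    exact h3
  rcases lt_or_ge u r with hur | hur
  · refine ⟨0, by simpa using hrX, by simp; linarith, ?_⟩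
    rw [pow_zero, one_mul, radialKernel_self hr hr1 hθ1, radialKernel, if_pos hur]
  · obtain ⟨j, h1, h2⟩ := exists_nat_pow_near ((one_le_div hr).2 hur) one_lt_two
    rw [le_div_iff₀ hr] at h1
    rw [div_lt_iff₀ hr, pow_succ] at h2
    exact ⟨j, h1.trans huX, by linarith,
      radialKernel_antitone hr hr1 hθ1 hs hst (by positivity) h1⟩

end Radial

/-! ### Averages over discrete Frostman measures on the Grassmannian. -/

theorem sum_biUnion_le_sum_of_nonneg {α β : Type*} [DecidableEq α] [DecidableEq β]
    (s : Finset β) (t : β → Finset α) {w : α → ℝ} (hw : ∀ a, 0 ≤ w a) :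
    ∑ a ∈ s.biUnion t, w a ≤ ∑ b ∈ s, ∑ a ∈ t b, w a := by
  induction s using Finset.induction_on with
  | empty => simp
  | insert b s hb ih =>
    rw [Finset.biUnion_insert, Finset.sum_insert hb]
    have h1 := Finset.sum_union_inter (s₁ := t b) (s₂ := s.biUnion t) (f := w)
    have h2 : 0 ≤ ∑ a ∈ t b ∩ s.biUnion t, w a := Finset.sum_nonneg fun a _ => hw a
    linarith

/-- A discrete Frostman measure gives little mass to the subspaces almost orthogonal to `x`. -/
theorem Grassmannian.exists_slab_mass_bound (hmn : m < n) {lam : ℝ} (hlam : 0 ≤ lam) :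
    ∃ K : ℝ, 1 ≤ K ∧ ∀ (ρ₀ : ℝ) (N : Finset (Grassmannian n m)) (w : Grassmannian n m → ℝ),
      0 < ρ₀ → (∀ V, 0 ≤ w V) →
      (∀ V ∈ N, ∀ ρ, ρ₀ ≤ ρ →
        ∑ W ∈ N with dist W V ≤ ρ, w W ≤ ρ ^ (((m * (n - m - 1) : ℕ) : ℝ) + lam)) →
      ∀ (x : RSpace n) (δ : ℝ), x ≠ 0 → ρ₀ ≤ δ → δ ≤ 2 →
        ∑ V ∈ N with ‖V.proj x‖ ≤ δ * ‖x‖, w V ≤ K * δ ^ lam := by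
  classical
  obtain ⟨K, hK, hcells⟩ := Grassmannian.exists_cells_slab hmn
  set p := m * (n - m - 1)
  have hK0 : 0 < K := by linarith
  refine ⟨K * K ^ ((p : ℝ) + lam), ?_, ?_⟩
  · exact one_le_mul_of_one_le_of_one_le hK (Real.one_le_rpow hK (by positivity))
  intro ρ₀ N w hρ₀ hw0 hw x δ hx hδ hδ2
  have hδ0 := hρ₀.trans_le hδ
  obtain ⟨𝒜, hcov, hdiam, hcard⟩ := hcells x δ hx hδ0 hδ2
  have hcell : ∀ C ∈ 𝒜, ∑ V ∈ N with V ∈ C, w V ≤ (K * δ) ^ ((p : ℝ) + lam) := by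
    intro C hC
    rcases (N.filter fun V => V ∈ C).eq_empty_or_nonempty with h | ⟨V₀, hV₀⟩
    · rw [h, Finset.sum_empty]
      positivity
    · obtain ⟨hV₀N, hV₀C⟩ := Finset.mem_filter.1 hV₀
      refine le_trans ?_ (hw V₀ hV₀N (K * δ) (by nlinarith))
      refine Finset.sum_le_sum_of_subset_of_nonneg (fun V hV => ?_) fun V _ _ => hw0 V
      obtain ⟨hVN, hVC⟩ := Finset.mem_filter.1 hV
      exact Finset.mem_filter.2 ⟨hVN, hdiam C hC V hVC V₀ hV₀C⟩
  calc ∑ V ∈ N with ‖V.proj x‖ ≤ δ * ‖x‖, w V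
      ≤ ∑ V ∈ 𝒜.biUnion fun C => N.filter fun V => V ∈ C, w V := by
        refine Finset.sum_le_sum_of_subset_of_nonneg (fun V hV => ?_) fun V _ _ => hw0 V
        obtain ⟨hVN, hVx⟩ := Finset.mem_filter.1 hV
        obtain ⟨C, hC, hVC⟩ := mem_iUnion₂.1 (hcov hVx)
        exact Finset.mem_biUnion.2 ⟨C, hC, Finset.mem_filter.2 ⟨hVN, hVC⟩⟩
    _ ≤ ∑ C ∈ 𝒜, ∑ V ∈ N with V ∈ C, w V :=
        sum_biUnion_le_sum_of_nonneg _ _ hw0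
    _ ≤ ∑ _C ∈ 𝒜, (K * δ) ^ ((p : ℝ) + lam) := Finset.sum_le_sum hcell
    _ = 𝒜.card * (K * δ) ^ ((p : ℝ) + lam) := by rw [Finset.sum_const, nsmul_eq_mul]
    _ ≤ (K * (1 / δ) ^ p) * (K * δ) ^ ((p : ℝ) + lam) := by gcongr
    _ = K * K ^ ((p : ℝ) + lam) * δ ^ lam := by
        rw [Real.mul_rpow hK0.le hδ0.le, Real.rpow_add hδ0, Real.rpow_natCast, one_div, inv_pow]
        field_simp

/-- The average of the kernel over the projections with respect to a discrete Frostman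
measure. -/
theorem Grassmannian.exists_kernel_average_bound (hmn : m < n) {lam : ℝ} (hlam : 0 ≤ lam)
    (hlam_le : lam ≤ m) :
    ∃ K : ℝ, 1 ≤ K ∧ ∀ (θ s r B : ℝ) (J : ℕ) (N : Finset (Grassmannian n m))
      (w : Grassmannian n m → ℝ), θ ≤ 1 → 0 ≤ s → s ≤ lam → 0 < r → r < 1 → 1 ≤ B →
      B ≤ 2 ^ J * r → (∀ V, 0 ≤ w V) →
      (∀ V ∈ N, ∀ ρ, r / B ≤ ρ →
        ∑ W ∈ N with dist W V ≤ ρ, w W ≤ ρ ^ (((m * (n - m - 1) : ℕ) : ℝ) + lam)) →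
      ∀ x : RSpace n, ‖x‖ ≤ B →
        ∑ V ∈ N, w V * kernel r θ s m (V.proj x) ≤ K * (J + 1) * kernel r θ s lam x := by
  obtain ⟨K, hK, hslab⟩ := Grassmannian.exists_slab_mass_bound hmn hlam
  have h2l : (1 : ℝ) ≤ 2 ^ lam := Real.one_le_rpow (by norm_num) hlam
  refine ⟨K * 2 ^ lam, one_le_mul_of_one_le_of_one_le hK h2l, ?_⟩
  intro θ s r B J N w hθ1 hs hsl hr hr1 hB hJ hw0 hw x hxB
  have hB0 : 0 < B := by linarith
  have hslab' := hslab (r / B) N w (by positivity) hw0 hw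
  rcases lt_or_ge ‖x‖ r with hxr | hxr
  · have hn : 0 < n := by omega
    have hne : (EuclideanSpace.single ⟨0, hn⟩ 1 : RSpace n) ≠ 0 := by
      rw [ne_eq, ← norm_eq_zero]
      simp
    -- The slab with δ = 1 around any nonzero vector is the whole Grassmannian, so this bounds the
    -- total mass.
    have htot := hslab' _ 1 hne ((div_le_one hB0).2 (by linarith)) (by norm_num)
    rw [Real.one_rpow, mul_one, Finset.filter_true_of_mem fun V _ => by
      rw [one_mul]; exact V.norm_proj_apply_le _] at htot
    have hk : kernel r θ s lam x = 1 := by rw [kernel, if_pos hxr]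
    rw [hk, mul_one]
    calc ∑ V ∈ N, w V * kernel r θ s m (V.proj x) ≤ ∑ V ∈ N, w V :=
          Finset.sum_le_sum fun V _ => mul_le_of_le_one_right (hw0 V)
            (kernel_le_one hr hr1 hθ1 hs (hsl.trans hlam_le) _)
      _ ≤ K := htot
      _ ≤ K * (2 ^ lam * (J + 1)) := by
          refine le_mul_of_one_le_right (by linarith) ?_
          exact one_le_mul_of_one_le_of_one_le h2l (by simp)
      _ = _ := by ring
  · have hx0 : 0 < ‖x‖ := hr.trans_le hxr
    set F := (Finset.range (J + 1)).filter fun j => 2 ^ j * r ≤ ‖x‖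
    calc ∑ V ∈ N, w V * kernel r θ s m (V.proj x)
        ≤ ∑ V ∈ N, w V * ∑ j ∈ F, radialKernel r θ s m (2 ^ j * r) *
            if ‖V.proj x‖ ≤ 2 * (2 ^ j * r) then 1 else 0 := by
          refine Finset.sum_le_sum fun V _ => mul_le_mul_of_nonneg_left ?_ (hw0 V)
          rw [kernel_eq_radialKernel]
          exact radialKernel_le_sum_layers hr hr1 hθ1 hs (hsl.trans hlam_le)
            (V.norm_proj_apply_le x) hxr (hxB.trans hJ)
      _ = ∑ j ∈ F, radialKernel r θ s m (2 ^ j * r) *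
            ∑ V ∈ N with ‖V.proj x‖ ≤ 2 * (2 ^ j * r), w V := by
          simp_rw [Finset.mul_sum]
          rw [Finset.sum_comm]
          refine Finset.sum_congr rfl fun j _ => ?_
          rw [Finset.sum_filter]
          refine Finset.sum_congr rfl fun V _ => ?_
          split_ifs <;> ring
      -- Every layer obeys the same bound, so the sum costs only the number of layers.
      _ ≤ ∑ _j ∈ F, K * 2 ^ lam * radialKernel r θ s lam ‖x‖ := by
          refine Finset.sum_le_sum fun j hj => ?_
          have hjx := (Finset.mem_filter.1 hj).2
          have hp : 0 < 2 ^ j * r := by positivity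
          have h1 : (1 : ℝ) ≤ 2 ^ j := one_le_pow₀ (by norm_num)
          have hδ := hslab' x (2 * (2 ^ j * r) / ‖x‖) (norm_pos_iff.1 hx0)
            (by
              rw [div_le_div_iff₀ hB0 hx0]
              calc r * ‖x‖ ≤ (2 * (2 ^ j * r)) * B := by
                    gcongr
                    nlinarith
                _ = _ := rfl)
            (by rw [div_le_iff₀ hx0]; linarith)
          rw [div_mul_cancel₀ _ hx0.ne'] at hδ
          calc radialKernel r θ s m (2 ^ j * r) *
                ∑ V ∈ N with ‖V.proj x‖ ≤ 2 * (2 ^ j * r), w V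
              ≤ radialKernel r θ s m (2 ^ j * r) * (K * (2 * (2 ^ j * r) / ‖x‖) ^ lam) :=
                mul_le_mul_of_nonneg_left hδ (radialKernel_nonneg hr hr1 hθ1 hp)
            _ = K * 2 ^ lam *
                (radialKernel r θ s m (2 ^ j * r) * ((2 ^ j * r) / ‖x‖) ^ lam) := by
                rw [mul_div_assoc, Real.mul_rpow (by norm_num) (by positivity)]
                ring
            _ ≤ _ := by
                gcongr
                exact radialKernel_mul_div_rpow_le hr hr1 hθ1 hs hsl hlam_le hp hjx
      _ = F.card * (K * 2 ^ lam * kernel r θ s lam x) := by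
          rw [Finset.sum_const, nsmul_eq_mul, kernel_eq_radialKernel]
      _ ≤ (J + 1) * (K * 2 ^ lam * kernel r θ s lam x) := by
          have hc : (F.card : ℝ) ≤ J + 1 := by
            exact_mod_cast (Finset.card_filter_le _ _).trans_eq (Finset.card_range _)
          have hk : 0 ≤ kernel r θ s lam x := by
            rw [kernel_eq_radialKernel]; exact radialKernel_nonneg hr hr1 hθ1 hx0
          gcongr
      _ = _ := by ring

/-! ### Energies of projections and mass distribution. -/

theorem kernel_nonneg {r θ s t : ℝ} (hr : 0 < r) (x : RSpace n) : 0 ≤ kernel r θ s t x := by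
  unfold kernel
  split_ifs <;> positivity

theorem measurable_kernel (r θ s t : ℝ) :
    Measurable (kernel r θ s t : RSpace n → ℝ) := by
  unfold kernel
  refine Measurable.ite (measurableSet_lt measurable_norm measurable_const) measurable_const ?_
  refine Measurable.ite (measurableSet_lt measurable_norm measurable_const) ?_ ?_
  · exact (measurable_const.div measurable_norm).pow_const s
  · exact measurable_const.div (measurable_norm.pow_const t)

theorem kernel_anti_exponent {r θ s t t' : ℝ} (hr : 0 < r) (hr1 : r < 1) (hθ1 : θ ≤ 1)
    (htt : t ≤ t') (x : RSpace n) : kernel r θ s t' x ≤ kernel r θ s t x := by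
  rcases (norm_nonneg x).eq_or_lt with h | h
  · simp [kernel, ← h, hr]
  · exact radialKernel_anti_exponent hr hr1 hθ1 htt h

theorem kernel_lower_of_norm_le {r θ s t d : ℝ} (hr : 0 < r) (hr1 : r < 1) (hθ1 : θ ≤ 1)
    (hs : 0 ≤ s) (hst : s ≤ t) (hd : r ≤ d) (hd2 : d ≤ 2 * r ^ θ) (x : RSpace n) (hx : ‖x‖ ≤ d) :
    2 ^ (-t) * (r / d) ^ s ≤ kernel r θ s t x := by
  refine (radialKernel_lower hr hr1 hθ1 hs hst hd hd2).trans ?_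
  rw [kernel_eq_radialKernel]
  rcases lt_or_ge ‖x‖ r with h | h
  · rw [radialKernel.eq_1 r θ s t ‖x‖, if_pos h, ← radialKernel_self (s := s) (t := t) hr hr1 hθ1]
    exact radialKernel_antitone hr hr1 hθ1 hs hst hr hd
  · exact radialKernel_antitone hr hr1 hθ1 hs hst (hr.trans_le h) hx

/-- The energy of the image of `μ` under the projection `π_V`, for the kernel of exponent `m`. -/
noncomputable def projEnergy (r θ s : ℝ) (V : Grassmannian n m) (μ : Measure (RSpace n)) : ℝ≥0∞ :=
  ∫⁻ x, ∫⁻ y, ENNReal.ofReal (kernel r θ s m (V.proj (x - y))) ∂μ ∂μ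

theorem measurable_projKernel (r θ s : ℝ) (V : Grassmannian n m) :
    Measurable fun p : RSpace n × RSpace n =>
      ENNReal.ofReal (kernel r θ s m (V.proj (p.1 - p.2))) :=
  ((measurable_kernel r θ s m).comp
    (V.proj.continuous.measurable.comp (measurable_fst.sub measurable_snd))).ennreal_ofReal

theorem sum_mul_projEnergy_le {r θ s lam c : ℝ} (N : Finset (Grassmannian n m))
    (w : Grassmannian n m → ℝ) (hw0 : ∀ V, 0 ≤ w V) (hr : 0 < r) (hc : 0 ≤ c)
    {E : Set (RSpace n)} (μ : Measure (RSpace n)) [SFinite μ] (hμ : μ Eᶜ = 0)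
    (h : ∀ x ∈ E, ∀ y ∈ E, ∑ V ∈ N, w V * kernel r θ s m (V.proj (x - y)) ≤
      c * kernel r θ s lam (x - y)) :
    ∑ V ∈ N, ENNReal.ofReal (w V) * projEnergy r θ s V μ ≤
      ENNReal.ofReal c * energy r θ s lam μ := by
  have hae : ∀ᵐ x ∂μ, x ∈ E := hμ
  have hmeas := fun V : Grassmannian n m => measurable_projKernel r θ s V
  calc ∑ V ∈ N, ENNReal.ofReal (w V) * projEnergy r θ s V μ
      = ∫⁻ x, ∫⁻ y, ∑ V ∈ N, ENNReal.ofReal (w V) *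
          ENNReal.ofReal (kernel r θ s m (V.proj (x - y))) ∂μ ∂μ := by
        unfold projEnergy
        simp_rw [← lintegral_const_mul' _ _ ENNReal.ofReal_ne_top]
        rw [← lintegral_finsetSum]
        · refine lintegral_congr fun x => ?_
          rw [← lintegral_finsetSum]
          exact fun V _ => ((hmeas V).comp measurable_prodMk_left).const_mul _
        · exact fun V _ => ((hmeas V).const_mul _).lintegral_prod_right'
    _ ≤ ∫⁻ x, ∫⁻ y, ENNReal.ofReal c * ENNReal.ofReal (kernel r θ s lam (x - y)) ∂μ ∂μ := by
        refine lintegral_mono_ae ?_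
        filter_upwards [hae] with x hx
        refine lintegral_mono_ae ?_
        filter_upwards [hae] with y hy
        rw [← ENNReal.ofReal_mul hc]
        simp_rw [← ENNReal.ofReal_mul (hw0 _)]
        rw [← ENNReal.ofReal_sum_of_nonneg fun V _ => mul_nonneg (hw0 V) (kernel_nonneg hr _)]
        exact ENNReal.ofReal_le_ofReal (h x hx y hy)
    _ = _ := by
        unfold energy
        simp_rw [lintegral_const_mul' _ _ ENNReal.ofReal_ne_top]

/-- The mass distribution principle for covers of a projection. -/
theorem rpow_le_mul_sum_of_projEnergy_lt {r θ s a : ℝ} (hr : 0 < r) (hr1 : r < 1)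
    (hθ1 : θ ≤ 1) (hs : 0 ≤ s) (hsm : s ≤ m) (ha : 0 < a) {E : Set (RSpace n)}
    (μ : Measure (RSpace n)) [IsProbabilityMeasure μ] (hμ : μ Eᶜ = 0) (V : Grassmannian n m)
    (hV : projEnergy r θ s V μ < ENNReal.ofReal a) (𝒰 : Finset (Set (RSpace n)))
    (hcov : V.proj '' E ⊆ ⋃ U ∈ 𝒰, U)
    (hdiam : ∀ U ∈ 𝒰, r ≤ Metric.diam U ∧ Metric.diam U ≤ 2 * r ^ θ) :
    r ^ s ≤ 2 ^ (m + 2) * a * ∑ U ∈ 𝒰, Metric.diam U ^ s := by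
  set f : RSpace n × RSpace n → ℝ≥0∞ := fun p =>
    ENNReal.ofReal (kernel r θ s m (V.proj (p.1 - p.2))) with hf
  have hmf : Measurable f := measurable_projKernel r θ s V
  set g : RSpace n → ℝ≥0∞ := fun x => ∫⁻ y, f (x, y) ∂μ with hg
  have hmg : Measurable g := hmf.lintegral_prod_right'
  -- Markov's inequality: the potential `g` is below twice the energy bound on at least half of the
  -- mass.
  have hgood : (1 / 2 : ℝ≥0∞) ≤ μ {x | g x < ENNReal.ofReal (2 * a)} := by
    have h1 := mul_meas_ge_le_lintegral hmg (μ := μ) (ENNReal.ofReal (2 * a))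
    have h2 : ENNReal.ofReal (2 * a) * μ {x | ENNReal.ofReal (2 * a) ≤ g x} ≤ ENNReal.ofReal a :=
      h1.trans hV.le
    have h3 : μ {x | ENNReal.ofReal (2 * a) ≤ g x} ≤ 1 / 2 := by
      rw [ENNReal.ofReal_mul (by norm_num), mul_assoc, mul_comm (ENNReal.ofReal a),
        ← mul_assoc] at h2
      have ha0 : ENNReal.ofReal a ≠ 0 := by simpa using ha
      have h4 := (ENNReal.le_div_iff_mul_le (Or.inl ha0) (Or.inl ENNReal.ofReal_ne_top)).2 h2
      rw [ENNReal.div_self ha0 ENNReal.ofReal_ne_top, mul_comm] at h4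
      rw [ENNReal.le_div_iff_mul_le (by simp) (by simp)]
      simpa using h4
    have h5 : {x | g x < ENNReal.ofReal (2 * a)} = {x | ENNReal.ofReal (2 * a) ≤ g x}ᶜ := by
      ext x; simp
    rw [h5, prob_compl_eq_one_sub (measurableSet_le measurable_const hmg)]
    have h6 : (1 : ℝ≥0∞) - 1 / 2 = 1 / 2 := by
      simp
    rw [← h6]
    exact tsub_le_tsub_left h3 1
  have hpiece : ∀ U ∈ 𝒰, μ (V.proj ⁻¹' U ∩ {x | g x < ENNReal.ofReal (2 * a)}) ≤
      ENNReal.ofReal (2 ^ (m + 1) * a / r ^ s * Metric.diam U ^ s) := by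
    intro U hU
    obtain ⟨hd, hd2⟩ := hdiam U hU
    set d := Metric.diam U
    have hd0 : 0 < d := hr.trans_le hd
    rcases (V.proj ⁻¹' U ∩ {x | g x < ENNReal.ofReal (2 * a)}).eq_empty_or_nonempty with h | h
    · rw [h, measure_empty]; exact zero_le
    · obtain ⟨x, hxU, hxg⟩ := h
      -- An unbounded set has `Metric.diam` equal to 0, which `r ≤ d` excludes.
      have hbdd : Bornology.IsBounded U := by
        by_contra hb
        have : d = 0 := Metric.diam_eq_zero_of_unbounded hb
        linarith
      set c : ℝ := 2 ^ (-(m : ℝ)) * (r / d) ^ s with hc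
      have hc0 : 0 < c := by positivity
      have hc0' : ENNReal.ofReal c ≠ 0 := by simpa using hc0
      -- Seen from one good point x over U, the kernel is at least c on the whole preimage of U, so
      -- the small potential at x bounds the mass of that preimage.
      have hsub : V.proj ⁻¹' U ⊆ {y | ENNReal.ofReal c ≤ f (x, y)} := fun y hy => by
        refine ENNReal.ofReal_le_ofReal (kernel_lower_of_norm_le hr hr1 hθ1 hs hsm hd hd2 _ ?_)
        simp only
        rw [map_sub, ← dist_eq_norm]
        exact Metric.dist_le_diam_of_mem hbdd hxU hy
      have h1 := mul_meas_ge_le_lintegral (hmf.comp (measurable_prodMk_left (x := x))) (μ := μ)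
        (ENNReal.ofReal c)
      have h2 : ENNReal.ofReal c * μ (V.proj ⁻¹' U) ≤ ENNReal.ofReal (2 * a) :=
        (mul_le_mul_right (measure_mono hsub) _).trans (h1.trans (le_of_lt hxg))
      refine (measure_mono inter_subset_left).trans ?_
      rw [mul_comm, ← ENNReal.le_div_iff_mul_le (Or.inl hc0') (Or.inl ENNReal.ofReal_ne_top),
        ← ENNReal.ofReal_div_of_pos hc0] at h2
      refine h2.trans_eq ?_
      congr 1
      rw [hc, Real.div_rpow hr.le hd0.le, Real.rpow_neg (by norm_num), Real.rpow_natCast]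
      field_simp
      ring
  have hcover : {x | g x < ENNReal.ofReal (2 * a)} ⊆
      Eᶜ ∪ ⋃ U ∈ 𝒰, (V.proj ⁻¹' U ∩ {x | g x < ENNReal.ofReal (2 * a)}) := by
    intro x hx
    by_cases hxE : x ∈ E
    · obtain ⟨U, hU, hxU⟩ := mem_iUnion₂.1 (hcov (mem_image_of_mem _ hxE))
      exact Or.inr (mem_iUnion₂.2 ⟨U, hU, hxU, hx⟩)
    · exact Or.inl hxE
  have htotal : (1 / 2 : ℝ≥0∞) ≤
      ENNReal.ofReal (∑ U ∈ 𝒰, 2 ^ (m + 1) * a / r ^ s * Metric.diam U ^ s) := by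
    calc (1 / 2 : ℝ≥0∞) ≤ μ {x | g x < ENNReal.ofReal (2 * a)} := hgood
      _ ≤ μ Eᶜ + μ (⋃ U ∈ 𝒰, (V.proj ⁻¹' U ∩ {x | g x < ENNReal.ofReal (2 * a)})) :=
          (measure_mono hcover).trans (measure_union_le _ _)
      _ ≤ ∑ U ∈ 𝒰, μ (V.proj ⁻¹' U ∩ {x | g x < ENNReal.ofReal (2 * a)}) := by
          rw [hμ, zero_add]; exact measure_biUnion_finset_le _ _
      _ ≤ ∑ U ∈ 𝒰, ENNReal.ofReal (2 ^ (m + 1) * a / r ^ s * Metric.diam U ^ s) :=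
          Finset.sum_le_sum hpiece
      _ = _ := (ENNReal.ofReal_sum_of_nonneg fun U hU => by
          have := Metric.diam_nonneg (s := U)
          positivity).symm
  have hhalf : (1 / 2 : ℝ≥0∞) = ENNReal.ofReal (1 / 2) := by
    rw [ENNReal.ofReal_div_of_pos (by norm_num)]; simp
  rw [hhalf, ENNReal.ofReal_le_ofReal_iff' , ← Finset.mul_sum] at htotal
  rcases htotal with h | h
  · have hrs : 0 < r ^ s := by positivity
    rw [div_mul_eq_mul_div, div_le_div_iff₀ (by norm_num) hrs, one_mul] at h
    calc r ^ s ≤ _ := h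
      _ = _ := by ring
  · norm_num at h

/-- The factor 2 leaves room above the infimum, so no minimising measure is needed. -/
theorem exists_energy_lt_of_le_capacity {r θ s t b : ℝ} (hb : 0 < b) {E : Set (RSpace n)}
    (hcap : b⁻¹ ≤ (capacity r θ s t E).toReal) :
    ∃ μ : Measure (RSpace n), IsProbabilityMeasure μ ∧ μ Eᶜ = 0 ∧
      energy r θ s t μ < ENNReal.ofReal (2 * b) := by
  have h1 : ENNReal.ofReal b⁻¹ ≤ capacity r θ s t E :=
    (ENNReal.ofReal_le_ofReal hcap).trans ENNReal.ofReal_toReal_le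
  rw [ENNReal.ofReal_inv_of_pos hb, capacity, ENNReal.inv_le_inv] at h1
  have h2 : ENNReal.ofReal b < ENNReal.ofReal (2 * b) :=
    (ENNReal.ofReal_lt_ofReal_iff (by positivity)).2 (by linarith)
  obtain ⟨μ, hμ⟩ := iInf_lt_iff.1 (h1.trans_lt h2)
  obtain ⟨⟨hp, h0⟩, hμ⟩ := iInf_lt_iff.1 hμ
  exact ⟨μ, hp, h0, hμ⟩

/-- A set of positive capacity carries a measure such that all the projections with an exceptional
cover have large energy. -/
theorem exists_measure_of_le_capacity {r θ s lam γ : ℝ} (hr : 0 < r) (hr1 : r < 1) (hθ1 : θ ≤ 1)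
    (hs : 0 ≤ s) (hsm : s ≤ m) (hγr : 2 ^ (m + 1) * r ^ γ < 1) {E : Set (RSpace n)}
    (hcap : r ^ (-(s + 2 * γ)) ≤ (capacity r θ s lam E).toReal) :
    ∃ μ : Measure (RSpace n), IsProbabilityMeasure μ ∧ μ Eᶜ = 0 ∧
      energy r θ s lam μ < ENNReal.ofReal (2 * r ^ (s + 2 * γ)) ∧
      ∀ V : Grassmannian n m, HasCover (V.proj '' E) r (2 * r ^ θ) s (1 / 2) →
        ENNReal.ofReal (r ^ (s + γ)) ≤ projEnergy r θ s V μ := by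
  rw [Real.rpow_neg hr.le] at hcap
  obtain ⟨μ, hp, h0, hμ⟩ := exists_energy_lt_of_le_capacity (by positivity) hcap
  refine ⟨μ, hp, h0, hμ, fun V ⟨𝒰, hcov, hdiam, hsum⟩ => ?_⟩
  by_contra! hlt
  have h1 := rpow_le_mul_sum_of_projEnergy_lt hr hr1 hθ1 hs hsm (by positivity) μ h0 V hlt 𝒰
    hcov hdiam
  have hrs : 0 < r ^ s := by positivity
  have h2 : r ^ s ≤ r ^ s * (2 ^ (m + 1) * r ^ γ) := by
    calc r ^ s ≤ 2 ^ (m + 2) * r ^ (s + γ) * ∑ U ∈ 𝒰, Metric.diam U ^ s := h1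
      _ ≤ 2 ^ (m + 2) * r ^ (s + γ) * (1 / 2) := by gcongr
      _ = _ := by rw [Real.rpow_add hr]; ring
  nlinarith

/-! ### Exceptional subspaces at a single scale. -/

/-- With y = B/r this absorbs the logarithmic number of dyadic layers into an arbitrarily small
power of r. -/
theorem exists_pow_two_ge {y ε : ℝ} (hy : 1 ≤ y) (hε : 0 < ε) :
    ∃ J : ℕ, y ≤ 2 ^ J ∧ (J + 1 : ℝ) ≤ (1 / (ε * Real.log 2) + 2) * y ^ ε := by
  obtain ⟨k, h1, h2⟩ := exists_nat_pow_near hy one_lt_two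
  refine ⟨k + 1, h2.le, ?_⟩
  have hl2 : 0 < Real.log 2 := Real.log_pos one_lt_two
  have h3 : k * Real.log 2 ≤ y ^ ε / ε := by
    rw [← Real.log_pow]
    exact (Real.log_le_log (by positivity) h1).trans (Real.log_le_rpow_div (by linarith) hε)
  have h4 : (1 : ℝ) ≤ y ^ ε := Real.one_le_rpow hy hε.le
  have h5 : (k : ℝ) ≤ 1 / (ε * Real.log 2) * y ^ ε := by
    rw [← le_div_iff₀ hl2] at h3
    refine h3.trans_eq ?_
    field_simp
  push_cast
  linarith

/-- At a scale where `E` has large capacity, the set of exceptional subspaces has an efficient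
cover. -/
theorem exists_hasBallCover_exceptional (hmn : m < n) {θ s lam γ : ℝ} (hθ1 : θ ≤ 1)
    (hs : 0 ≤ s) (hsl : s ≤ lam) (hlam_le : lam ≤ m) (hγ : 0 < γ) {E : Set (RSpace n)}
    (hE : IsCompact E) :
    ∃ C : ℝ, 0 ≤ C ∧ ∀ r : ℝ, 0 < r → r < 1 → 2 ^ (m + 1) * r ^ γ < 1 →
      r ^ (-(s + 2 * γ)) ≤ (capacity r θ s lam E).toReal →
      HasBallCover {V : Grassmannian n m | HasCover (V.proj '' E) r (2 * r ^ θ) s (1 / 2)}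
        (((m * (n - m - 1) : ℕ) : ℝ) + lam) (C * r ^ (γ / 2)) := by
  obtain ⟨B, hB, hEB⟩ := exists_diam_bound hE
  have hlam : 0 ≤ lam := hs.trans hsl
  obtain ⟨K, hK, havg⟩ := Grassmannian.exists_kernel_average_bound hmn hlam hlam_le
  have hB0 : 0 < B := by linarith
  set D : ℝ := ((m * (n - m - 1) : ℕ) : ℝ) + lam with hD
  have hl2 : 0 < Real.log 2 := Real.log_pos one_lt_two
  set L : ℝ := 1 / (γ / 2 * Real.log 2) + 2 with hL
  have hL0 : 0 < L := by positivity
  refine ⟨6 ^ D * (2 * K * L * B ^ (γ / 2)), by positivity, fun r hr hr1 hγr hcap => ?_⟩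
  obtain ⟨μ, hp, h0, hμ, hbad⟩ := exists_measure_of_le_capacity (m := m) hr hr1 hθ1 hs
    (hsl.trans hlam_le) hγr hcap
  obtain ⟨J, hJ, hJ2⟩ := exists_pow_two_ge (y := B / r) (ε := γ / 2)
    ((one_le_div hr).2 (by linarith)) (by positivity)
  rw [div_le_iff₀ hr] at hJ
  rw [mul_assoc]
  refine hasBallCover_of_frostman_bound (Grassmannian.totallyBounded_univ.subset (subset_univ _))
    (ρ₀ := r / B) (by positivity) (by positivity) fun N w hN hw0 hw => ?_
  have hsum := sum_mul_projEnergy_le (c := K * (J + 1)) N w hw0 hr (by positivity) μ h0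
    fun x hx y hy => havg θ s r B J N w hθ1 hs hsl hr hr1 hB hJ hw0 hw (x - y) (hEB x hx y hy)
  have h1 : ENNReal.ofReal (∑ V ∈ N, w V) * ENNReal.ofReal (r ^ (s + γ)) ≤
      ENNReal.ofReal (K * (J + 1)) * ENNReal.ofReal (2 * r ^ (s + 2 * γ)) := by
    rw [ENNReal.ofReal_sum_of_nonneg fun V _ => hw0 V, Finset.sum_mul]
    refine le_trans (Finset.sum_le_sum fun V hV => ?_) (hsum.trans ?_)
    · gcongr
      exact hbad V (hN hV)
    · gcongr
  rw [← ENNReal.ofReal_mul (Finset.sum_nonneg fun V _ => hw0 V), ← ENNReal.ofReal_mul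
    (by positivity), ENNReal.ofReal_le_ofReal_iff (by positivity)] at h1
  -- Upper and lower energy bounds differ by the factor r^γ. Half of this exponent is then spent on
  -- `J + 1`.
  have h2 : ∑ V ∈ N, w V ≤ 2 * K * (J + 1) * r ^ γ := by
    have hpos : 0 < r ^ (s + γ) := by positivity
    refine le_of_mul_le_mul_right (h1.trans_eq ?_) hpos
    have : r ^ (s + 2 * γ) = r ^ γ * r ^ (s + γ) := by rw [← Real.rpow_add hr]; congr 1; ring
    rw [this]; ring
  calc ∑ V ∈ N, w V ≤ 2 * K * (J + 1) * r ^ γ := h2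
    _ ≤ 2 * K * (L * (B / r) ^ (γ / 2)) * r ^ γ := by gcongr
    _ = 2 * K * L * B ^ (γ / 2) * r ^ (γ / 2) := by
        have : r ^ γ = r ^ (γ / 2) * r ^ (γ / 2) := by rw [← Real.rpow_add hr]; congr 1; ring
        rw [Real.div_rpow hB0.le hr.le, this]
        have hpos : 0 < r ^ (γ / 2) := by positivity
        field_simp

theorem Grassmannian.proj_apply_of_eq (hmn : m = n) (V : Grassmannian n m) (x : RSpace n) :
    V.proj x = x := by
  have htop : V.1 = ⊤ := Submodule.eq_top_of_finrank_eq (by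
    rw [V.2, finrank_euclideanSpace_fin, hmn])
  exact Submodule.starProjection_eq_self_iff.2 (by rw [htop]; trivial)

/-- Here π_V is the identity and λ ≤ m makes the projected kernel the smaller one. No averaging is
needed: the energy would be both at least r^(s+γ) and below 2r^(s+2γ). -/
theorem not_hasCover_of_le_capacity (hmn : m = n) {r θ s lam γ : ℝ} (hr : 0 < r) (hr1 : r < 1)
    (hθ1 : θ ≤ 1) (hs : 0 ≤ s) (hsl : s ≤ lam) (hlam_le : lam ≤ m)
    (hγr : 2 ^ (m + 1) * r ^ γ < 1) {E : Set (RSpace n)}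
    (hcap : r ^ (-(s + 2 * γ)) ≤ (capacity r θ s lam E).toReal) (V : Grassmannian n m) :
    ¬ HasCover (V.proj '' E) r (2 * r ^ θ) s (1 / 2) := by
  intro hV
  obtain ⟨μ, -, -, hμ, hbad⟩ := exists_measure_of_le_capacity (m := m) hr hr1 hθ1 hs
    (hsl.trans hlam_le) hγr hcap
  have h1 : projEnergy r θ s V μ ≤ energy r θ s lam μ :=
    lintegral_mono fun x => lintegral_mono fun y => ENNReal.ofReal_le_ofReal (by
      rw [V.proj_apply_of_eq hmn]
      exact kernel_anti_exponent hr hr1 hθ1 hlam_le _)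
  have h2 := ((hbad V hV).trans h1).trans_lt hμ
  rw [ENNReal.ofReal_lt_ofReal_iff (by positivity)] at h2
  have h3 : r ^ (s + 2 * γ) = r ^ γ * r ^ (s + γ) := by rw [← Real.rpow_add hr]; congr 1; ring
  have h4 : 0 < r ^ (s + γ) := by positivity
  have h5 : (2 : ℝ) * r ^ γ ≤ 2 ^ (m + 1) * r ^ γ := by
    gcongr
    exact le_self_pow₀ (by norm_num) (by omega)
  rw [h3] at h2
  nlinarith

/-! ### Covers provided by the intermediate dimensions. -/

theorem HasCover.mono_exponent {E : Set (RSpace n)} {a b s s' ε : ℝ} (h : HasCover E a b s ε)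
    (ha : 0 < a) (hb : b ≤ 1) (hs : s ≤ s') : HasCover E a b s' ε := by
  obtain ⟨𝒰, h1, h2, h3⟩ := h
  refine ⟨𝒰, h1, h2, le_trans (Finset.sum_le_sum fun U hU => ?_) h3⟩
  exact Real.rpow_le_rpow_of_exponent_ge (ha.trans_le (h2 U hU).1) ((h2 U hU).2.trans hb) hs

theorem HasCover.mono {E : Set (RSpace n)} {a a' b b' s ε ε' : ℝ} (h : HasCover E a b s ε)
    (ha : a' ≤ a) (hb : b ≤ b') (hε : ε ≤ ε') : HasCover E a' b' s ε' := by
  obtain ⟨𝒰, h1, h2, h3⟩ := h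
  exact ⟨𝒰, h1, fun U hU => ⟨ha.trans (h2 U hU).1, (h2 U hU).2.trans hb⟩, h3.trans hε⟩

theorem HasBallCover.mono {X : Type*} [MetricSpace X] {A : Set X} {d η η' : ℝ}
    (h : HasBallCover A d η) (hη : η ≤ η') : HasBallCover A d η' := by
  obtain ⟨u, h1, h2, h3⟩ := h
  exact ⟨u, h1, h2, h3.trans hη⟩

/-- A bounded set is covered by about `r ^ (-n)` balls of diameter `r`. -/
theorem exists_hasCover_grid (hn : 1 ≤ n) {F : Set (RSpace n)} {B : ℝ} (hB : 0 ≤ B)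
    (hF : ∀ x ∈ F, ‖x‖ ≤ B) :
    ∃ C : ℝ, 0 < C ∧ ∀ r : ℝ, 0 < r → r ≤ 1 → HasCover F r r (n + 1) (C * r) := by
  classical
  have hnR : (1 : ℝ) ≤ n := by exact_mod_cast hn
  have hn0 : (0 : ℝ) < n := by linarith
  -- In a trivial space a closed ball has diameter 0 rather than twice its radius.
  have : Nontrivial (RSpace n) := by
    have : Nonempty (Fin n) := ⟨⟨0, hn⟩⟩
    infer_instance
  refine ⟨(2 * B * n + 7) ^ n, by positivity, fun r hr hr1 => ?_⟩
  set M : ℕ := ⌈B * n / r⌉₊ + 1 with hM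
  set c : (Fin n → ℤ) → RSpace n := fun z => WithLp.toLp 2 fun i => r / n * z i with hc
  set cells : Finset (Fin n → ℤ) := Fintype.piFinset fun _ => Finset.Icc (-(M : ℤ)) M
  have hdiam : ∀ z, Metric.diam (Metric.closedBall (c z) (r / 2)) = r := fun z => by
    rw [Metric.diam_closedBall_eq _ (by positivity)]; ring
  refine ⟨cells.image fun z => Metric.closedBall (c z) (r / 2), fun x hx => ?_, ?_, ?_⟩
  -- Rounding to the grid of mesh r/n moves each coordinate by at most r/(2n), hence the point by at
  -- most r/(2√n) ≤ r/2.
  · refine mem_iUnion₂.2 ⟨_, Finset.mem_image_of_mem _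
      (Fintype.mem_piFinset.2 fun i => ?_ :
        (fun i => round (x i * n / r)) ∈ cells), ?_⟩
    · have h1 : |x i| ≤ B := (PiLp.norm_apply_le x i).trans (hF x hx)
      have h2 := abs_sub_round (x i * n / r)
      have h3 : |x i * n / r| ≤ B * n / r := by
        rw [abs_div, abs_mul, abs_of_pos hr, abs_of_pos hn0]
        gcongr
      have h4 : B * n / r ≤ ⌈B * n / r⌉₊ := Nat.le_ceil _
      have h5 : |((round (x i * n / r) : ℤ) : ℝ)| ≤ M := by
        rw [hM]
        push_cast
        rw [abs_le] at h2 h3 ⊢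
        constructor <;> linarith
      rw [Finset.mem_Icc, ← abs_le]
      exact_mod_cast h5
    · rw [Metric.mem_closedBall, dist_eq_norm]
      refine abs_le_of_sq_le_sq' ?_ (by positivity) |>.2
      rw [EuclideanSpace.norm_sq_eq]
      calc ∑ i, ‖(x - c fun i => round (x i * n / r)) i‖ ^ 2
          ≤ ∑ _i : Fin n, (r / (2 * n)) ^ 2 := by
            refine Finset.sum_le_sum fun i _ => ?_
            gcongr
            have h2 := abs_sub_round (x i * n / r)
            have h3 : (x - c fun i => round (x i * n / r)) i =
                r / n * (x i * n / r - round (x i * n / r)) := by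
              simp only [hc, PiLp.sub_apply]
              field_simp
            rw [h3, Real.norm_eq_abs, abs_mul, abs_of_pos (by positivity)]
            calc r / n * |x i * n / r - round (x i * n / r)| ≤ r / n * (1 / 2) := by gcongr
              _ = _ := by field_simp
        _ = r ^ 2 / (4 * n) := by
            rw [Finset.sum_const, Finset.card_univ, Fintype.card_fin, nsmul_eq_mul]
            field_simp
            ring
        _ ≤ (r / 2) ^ 2 := by
            rw [div_le_iff₀ (by positivity)]
            have : 0 ≤ r ^ 2 := by positivity
            nlinarith
  · intro U hU
    obtain ⟨z, -, rfl⟩ := Finset.mem_image.1 hU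
    rw [hdiam]
    exact ⟨le_rfl, le_rfl⟩
  · have hcard : ((cells.image fun z => Metric.closedBall (c z) (r / 2)).card : ℝ) ≤
        ((2 * B * n + 7) / r) ^ n := by
      have h1 : (Finset.Icc (-(M : ℤ)) M).card = 2 * M + 1 := by
        rw [Int.card_Icc]; omega
      have h2 : cells.card = (2 * M + 1) ^ n := by
        simp [cells, Fintype.card_piFinset, h1]
      have h3 : (2 * M + 1 : ℝ) ≤ (2 * B * n + 7) / r := by
        have h4 := (Nat.ceil_lt_add_one (by positivity : 0 ≤ B * n / r)).le
        have h5 : 1 ≤ 1 / r := by rw [le_div_iff₀ hr]; linarith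
        have h6 : (2 * B * n + 7) / r = 2 * (B * n / r) + 7 * (1 / r) := by ring
        rw [h6, hM]
        push_cast
        linarith
      calc _ ≤ (cells.card : ℝ) := by exact_mod_cast Finset.card_image_le
        _ = (2 * M + 1 : ℝ) ^ n := by rw [h2]; push_cast; ring
        _ ≤ _ := by gcongr
    calc ∑ U ∈ cells.image fun z => Metric.closedBall (c z) (r / 2),
          Metric.diam U ^ ((n : ℝ) + 1)
        = ∑ U ∈ cells.image fun z => Metric.closedBall (c z) (r / 2), r ^ ((n : ℝ) + 1) := by
          refine Finset.sum_congr rfl fun U hU => ?_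
          obtain ⟨z, -, rfl⟩ := Finset.mem_image.1 hU
          rw [hdiam]
      _ ≤ ((2 * B * n + 7) / r) ^ n * r ^ ((n : ℝ) + 1) := by
          rw [Finset.sum_const, nsmul_eq_mul]
          gcongr
      _ = _ := by
          rw [Real.rpow_add hr, Real.rpow_natCast, Real.rpow_one, div_pow]
          field_simp

theorem rpow_one_div_le_self {θ r : ℝ} (hθ : 0 < θ) (hθ1 : θ ≤ 1) (hr : 0 < r) (hr1 : r ≤ 1) :
    r ^ (1 / θ) ≤ r := by
  simpa using Real.rpow_le_rpow_of_exponent_ge hr hr1 ((one_le_div hθ).2 hθ1)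

/-- Puts n + 1 into the sets whose infima define the intermediate dimensions. The real infimum of
the empty set is 0, so non-emptiness is needed before an upper bound on the infimum yields a cover.
-/
theorem exists_forall_hasCover_succ (hn : 1 ≤ n) {θ : ℝ} (hθ : 0 < θ) (hθ1 : θ ≤ 1)
    {F : Set (RSpace n)} (hF : Bornology.IsBounded F) {ε : ℝ} (hε : 0 < ε) :
    ∃ r₀ : ℝ, 0 < r₀ ∧ ∀ r : ℝ, 0 < r → r ≤ r₀ → HasCover F (r ^ (1 / θ)) r (n + 1) ε := by
  obtain ⟨B, hB0, hB⟩ := hF.exists_pos_norm_le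
  obtain ⟨C, hC, h⟩ := exists_hasCover_grid hn hB0.le hB
  refine ⟨min 1 (ε / C), by positivity, fun r hr hr0 => ?_⟩
  have hr1 := hr0.trans (min_le_left _ _)
  refine (h r hr hr1).mono (rpow_one_div_le_self hθ hθ1 hr hr1) le_rfl ?_
  have := hr0.trans (min_le_right _ _)
  rw [le_div_iff₀ hC] at this
  linarith

/-- The definition is read at scale r^θ, which turns the range [r^(1/θ), r] of diameters into [r,
r^θ], the range where the kernel decays like |x|^(-q). -/
theorem eventually_hasCover_of_upperIntermediateDim_lt (hn : 1 ≤ n) {θ q : ℝ} (hθ : 0 < θ)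
    (hθ1 : θ ≤ 1) {F : Set (RSpace n)} (hF : Bornology.IsBounded F)
    (hq : upperIntermediateDim θ F < q) :
    ∀ᶠ r : ℝ in 𝓝[>] 0, HasCover F r (r ^ θ) q (1 / 2) := by
  obtain ⟨s, ⟨-, hs⟩, hsq⟩ := exists_lt_of_csInf_lt (by
    exact ⟨(n : ℝ) + 1, by positivity, fun ε hε =>
      exists_forall_hasCover_succ hn hθ hθ1 hF hε⟩) hq
  obtain ⟨r₀, hr₀, h⟩ := hs (1 / 2) (by norm_num)
  have hlim : ∀ᶠ r : ℝ in 𝓝[>] 0, r ^ θ ≤ r₀ := by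
    have h1 : Tendsto (fun r : ℝ => r ^ θ) (𝓝[>] 0) (𝓝 0) := by
      have := (Real.continuousAt_rpow_const 0 θ (Or.inr hθ.le)).tendsto
      rw [Real.zero_rpow hθ.ne'] at this
      exact this.mono_left nhdsWithin_le_nhds
    exact h1.eventually (Iic_mem_nhds hr₀)
  filter_upwards [hlim, eventually_small] with r hr hr01
  have hp : 0 < r ^ θ := Real.rpow_pos_of_pos hr01.1 θ
  have h2 := h (r ^ θ) hp hr
  rw [← Real.rpow_mul hr01.1.le, mul_one_div_cancel hθ.ne', Real.rpow_one] at h2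
  exact h2.mono_exponent hr01.1 (Real.rpow_le_one hr01.1.le hr01.2.le hθ.le) hsq.le

theorem frequently_hasCover_of_lowerIntermediateDim_lt (hn : 1 ≤ n) {θ q : ℝ} (hθ : 0 < θ)
    (hθ1 : θ ≤ 1) {F : Set (RSpace n)} (hF : Bornology.IsBounded F)
    (hq : lowerIntermediateDim θ F < q) :
    ∃ᶠ r : ℝ in 𝓝[>] 0, HasCover F r (r ^ θ) q (1 / 2) := by
  obtain ⟨s, ⟨-, hs⟩, hsq⟩ := exists_lt_of_csInf_lt (by
    refine ⟨(n : ℝ) + 1, by positivity, fun ε hε r₀ hr₀ => ?_⟩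
    obtain ⟨r₁, hr₁, h⟩ := exists_forall_hasCover_succ hn hθ hθ1 hF hε
    exact ⟨min r₀ r₁, lt_min hr₀ hr₁, min_le_left _ _,
      h _ (lt_min hr₀ hr₁) (min_le_right _ _)⟩) hq
  rw [frequently_iff]
  intro U hU
  obtain ⟨u, hu, hsub⟩ := (mem_nhdsGT_iff_exists_Ioo_subset).1 hU
  have hu0 : 0 < u := hu
  obtain ⟨ρ, hρ, hρ0, h⟩ := hs (1 / 2) (by norm_num) (min (1 / 2) (u / 2)) (by positivity)
  have hρ1 : ρ ≤ 1 := by linarith [hρ0.trans (min_le_left _ _)]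
  have h1 := rpow_one_div_le_self hθ hθ1 hρ hρ1
  have hp : 0 < ρ ^ (1 / θ) := by positivity
  refine ⟨ρ ^ (1 / θ), hsub ⟨hp, by linarith [hρ0.trans (min_le_right _ _)]⟩, ?_⟩
  rw [← Real.rpow_mul hρ.le, one_div_mul_cancel hθ.ne', Real.rpow_one]
  exact h.mono_exponent hp hρ1 hsq.le

/-! ### Capacities below the profile. -/

theorem rpow_neg_le_capacity_of_le_rate {r θ s t v : ℝ} {E : Set (RSpace n)} (hr : 0 < r)
    (hr1 : r < 1) (hv : 0 < v) (h : v ≤ capacityRate θ s t E r) :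
    r ^ (-v) ≤ (capacity r θ s t E).toReal := by
  have hL : 0 < -Real.log r := by linarith [Real.log_neg hr hr1]
  rw [capacityRate, le_div_iff₀ hL] at h
  -- Were it 0, the convention log 0 = 0 would contradict v > 0.
  have hpos : 0 < (capacity r θ s t E).toReal := by
    refine lt_of_le_of_ne ENNReal.toReal_nonneg fun h0 => ?_
    rw [← h0, Real.log_zero] at h
    nlinarith
  rw [Real.rpow_def_of_pos hr, ← Real.le_log_iff_exp_le hpos]
  linarith

/-- Lowering the exponent from s₀ to q costs at most (1-θ)(s₀-q) in the rate. Of the gap s₀ - q the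
part θ(s₀-q) survives; half of it pays for the limit, and the other half is 2γ. -/
theorem capacityRate_transfer {θ q s₀ lam : ℝ} (hθ1 : θ ≤ 1) (hq : 0 ≤ q)
    (hqs : q < s₀) (hsl : s₀ ≤ lam) {E : Set (RSpace n)} (hE : IsCompact E) (hne : E.Nonempty)
    {r : ℝ} (hr : 0 < r) (hr1 : r < 1)
    (h : s₀ - θ * (s₀ - q) / 2 < capacityRate θ s₀ lam E r) (hθ : 0 < θ) :
    r ^ (-(q + 2 * (θ * (s₀ - q) / 4))) ≤ (capacity r θ q lam E).toReal := by
  obtain ⟨B, hB, hEB⟩ := exists_diam_bound hE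
  have h1 := (capacityRate_bounds hr hr1 hθ1 hq hqs.le hsl hB hne hEB).2.2.1
  have h2 : 0 < θ * (s₀ - q) := mul_pos hθ (sub_pos.2 hqs)
  exact rpow_neg_le_capacity_of_le_rate hr hr1 (by linarith) (by nlinarith)

theorem frequently_le_capacity_of_lt_upperProfile {θ q lam : ℝ} (hθ : 0 < θ) (hθ1 : θ ≤ 1)
    (hlam : 0 ≤ lam) {E : Set (RSpace n)} (hE : IsCompact E) (hne : E.Nonempty) (hq : 0 ≤ q)
    (hqs : q < upperProfile θ lam E) :
    q < lam ∧ ∃ γ : ℝ, 0 < γ ∧ ∃ᶠ r : ℝ in 𝓝[>] 0,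
      r ^ (-(q + 2 * γ)) ≤ (capacity r θ q lam E).toReal := by
  obtain ⟨⟨-, hsl⟩, hlim⟩ : upperProfile θ lam E ∈ Icc 0 lam ∧
      upperCapacityExponent θ (upperProfile θ lam E) lam E = (upperProfile θ lam E : EReal) :=
    Classical.epsilon_spec (existsUnique_upperProfile hθ hθ1 hlam hE hne).exists
  set s₀ := upperProfile θ lam E
  have h2 : 0 < θ * (s₀ - q) := mul_pos hθ (sub_pos.2 hqs)
  refine ⟨hqs.trans_le hsl, θ * (s₀ - q) / 4, by linarith, ?_⟩
  have h3 : ((s₀ - θ * (s₀ - q) / 2 : ℝ) : EReal) < upperCapacityExponent θ s₀ lam E := by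
    rw [hlim]
    exact_mod_cast (by linarith : s₀ - θ * (s₀ - q) / 2 < s₀)
  have h4 := frequently_lt_of_lt_limsup (by isBoundedDefault) h3
  refine (h4.and_eventually eventually_small).mono fun r ⟨hr, hr0, hr1⟩ => ?_
  exact capacityRate_transfer hθ1 hq hqs hsl hE hne hr0 hr1 (by exact_mod_cast hr) hθ

theorem eventually_le_capacity_of_lt_lowerProfile {θ q lam : ℝ} (hθ : 0 < θ) (hθ1 : θ ≤ 1)
    (hlam : 0 ≤ lam) {E : Set (RSpace n)} (hE : IsCompact E) (hne : E.Nonempty) (hq : 0 ≤ q)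
    (hqs : q < lowerProfile θ lam E) :
    q < lam ∧ ∃ γ : ℝ, 0 < γ ∧ ∀ᶠ r : ℝ in 𝓝[>] 0,
      r ^ (-(q + 2 * γ)) ≤ (capacity r θ q lam E).toReal := by
  obtain ⟨⟨-, hsl⟩, hlim⟩ : lowerProfile θ lam E ∈ Icc 0 lam ∧
      lowerCapacityExponent θ (lowerProfile θ lam E) lam E = (lowerProfile θ lam E : EReal) :=
    Classical.epsilon_spec (existsUnique_lowerProfile hθ hθ1 hlam hE hne).exists
  set s₀ := lowerProfile θ lam E
  have h2 : 0 < θ * (s₀ - q) := mul_pos hθ (sub_pos.2 hqs)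
  refine ⟨hqs.trans_le hsl, θ * (s₀ - q) / 4, by linarith, ?_⟩
  have h3 : ((s₀ - θ * (s₀ - q) / 2 : ℝ) : EReal) < lowerCapacityExponent θ s₀ lam E := by
    rw [hlim]
    exact_mod_cast (by linarith : s₀ - θ * (s₀ - q) / 2 < s₀)
  filter_upwards [eventually_lt_of_lt_liminf h3, eventually_small] with r hr hr01
  exact capacityRate_transfer hθ1 hq hqs hsl hE hne hr01.1 hr01.2 (by exact_mod_cast hr) hθ

/-! ### Dimension of the exceptional sets. -/

theorem eventually_scale_small (m : ℕ) {γ : ℝ} (hγ : 0 < γ) :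
    ∀ᶠ r : ℝ in 𝓝[>] 0, 0 < r ∧ r < 1 ∧ 2 ^ (m + 1) * r ^ γ < 1 := by
  have h1 : Tendsto (fun r : ℝ => 2 ^ (m + 1) * r ^ γ) (𝓝[>] 0) (𝓝 0) := by
    have := ((Real.continuousAt_rpow_const 0 γ (Or.inr hγ.le)).tendsto).const_mul
      ((2 : ℝ) ^ (m + 1))
    rw [Real.zero_rpow hγ.ne', mul_zero] at this
    exact this.mono_left nhdsWithin_le_nhds
  filter_upwards [h1.eventually (Iio_mem_nhds one_pos), eventually_small] with r hr hr01
  exact ⟨hr01.1, hr01.2, hr⟩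

theorem summable_const_mul_half_pow_rpow (C : ℝ) {γ : ℝ} (hγ : 0 < γ) :
    Summable fun k : ℕ => C * (((1 : ℝ) / 2) ^ k) ^ γ := by
  have h : ∀ k : ℕ, (((1 : ℝ) / 2) ^ k) ^ γ = (((1 : ℝ) / 2) ^ γ) ^ k := fun k => by
    rw [← Real.rpow_natCast, ← Real.rpow_natCast, ← Real.rpow_mul (by norm_num),
      ← Real.rpow_mul (by norm_num), mul_comm]
  simp_rw [h]
  exact (summable_geometric_of_lt_one (by positivity)
    (Real.rpow_lt_one (by norm_num) (by norm_num) hγ)).mul_left C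

section Exceptional

variable {θ q lam γ : ℝ} {E : Set (RSpace n)}

/-- The bad V have covers at all small scales, so the scales may be chosen where the capacity is
large, and below 2^(-k) to make the bounds summable. -/
theorem dimH_eventually_exceptional_le (hmn : m < n) (hθ1 : θ ≤ 1) (hq : 0 ≤ q)
    (hql : q < lam) (hlam_le : lam ≤ m) (hE : IsCompact E) (hγ : 0 < γ)
    (hcap : ∃ᶠ r : ℝ in 𝓝[>] 0, r ^ (-(q + 2 * γ)) ≤ (capacity r θ q lam E).toReal) :
    dimH {V : Grassmannian n m | ∀ᶠ r : ℝ in 𝓝[>] 0,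
      HasCover (V.proj '' E) r (r ^ θ) q (1 / 2)} ≤
        ENNReal.ofReal (((m * (n - m - 1) : ℕ) : ℝ) + lam) := by
  obtain ⟨C, hC, hcov⟩ :=
    exists_hasBallCover_exceptional hmn hθ1 hq hql.le hlam_le hγ hE
  have hex : ∀ k : ℕ, ∃ r : ℝ, (0 < r ∧ r < 1 ∧ 2 ^ (m + 1) * r ^ γ < 1) ∧ r < (1 / 2) ^ k ∧
      r ^ (-(q + 2 * γ)) ≤ (capacity r θ q lam E).toReal := fun k => by
    have h1 : ∀ᶠ r : ℝ in 𝓝[>] 0, r < (1 / 2) ^ k :=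
      mem_nhdsWithin_of_mem_nhds (Iio_mem_nhds (by positivity))
    obtain ⟨r, hr, h2, h3⟩ :=
      (hcap.and_eventually (h1.and (eventually_scale_small m hγ))).exists
    exact ⟨r, h3, h2, hr⟩
  choose r hr hrk hrcap using hex
  have hr0 : Tendsto r atTop (𝓝[>] 0) := by
    refine tendsto_nhdsWithin_iff.2 ⟨?_, Eventually.of_forall fun k => (hr k).1⟩
    exact squeeze_zero (fun k => (hr k).1.le) (fun k => (hrk k).le)
      (tendsto_pow_atTop_nhds_zero_of_lt_one (by norm_num) (by norm_num))
  refine dimH_le_of_frequently_mem (by have := hq.trans_lt hql; positivity) (fun k => by positivity)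
    (summable_const_mul_half_pow_rpow C (half_pos hγ)) (fun k =>
      (hcov (r k) (hr k).1 (hr k).2.1 (hr k).2.2 (hrcap k)).mono ?_) fun V hV => ?_
  · have := (hr k).1
    gcongr
    exact (hrk k).le
  · refine (hr0.eventually hV).frequently.mono fun k hk => hk.mono le_rfl ?_ le_rfl
    have := Real.rpow_pos_of_pos (hr k).1 θ
    linarith

/-- The good scales now depend on V, but the capacity is large at every small scale. Each scale is
rounded down to a power of 1/2; the upper limit on diameters then loses a factor 2^θ ≤ 2, for which
the bound `2 * r ^ θ` leaves room. -/
theorem dimH_frequently_exceptional_le (hmn : m < n) (hθ : 0 < θ) (hθ1 : θ ≤ 1) (hq : 0 ≤ q)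
    (hql : q < lam) (hlam_le : lam ≤ m) (hE : IsCompact E) (hγ : 0 < γ)
    (hcap : ∀ᶠ r : ℝ in 𝓝[>] 0, r ^ (-(q + 2 * γ)) ≤ (capacity r θ q lam E).toReal) :
    dimH {V : Grassmannian n m | ∃ᶠ r : ℝ in 𝓝[>] 0,
      HasCover (V.proj '' E) r (r ^ θ) q (1 / 2)} ≤
        ENNReal.ofReal (((m * (n - m - 1) : ℕ) : ℝ) + lam) := by
  obtain ⟨C, hC, hcov⟩ :=
    exists_hasBallCover_exceptional hmn hθ1 hq hql.le hlam_le hγ hE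
  obtain ⟨u, hu, hsub⟩ := mem_nhdsGT_iff_exists_Ioo_subset.1
    (hcap.and (eventually_scale_small m hγ))
  have hu0 : 0 < u := hu
  obtain ⟨k₀, hk₀⟩ := exists_pow_lt_of_lt_one hu0 (by norm_num : (1 / 2 : ℝ) < 1)
  have hpow : ∀ k : ℕ, ((1 : ℝ) / 2) ^ (k + k₀) ≤ (1 / 2) ^ k₀ := fun k =>
    pow_le_pow_of_le_one (by norm_num) (by norm_num) (by omega)
  refine dimH_le_of_frequently_mem (by have := hq.trans_lt hql; positivity) (fun k => by positivity)
    ((summable_nat_add_iff k₀).2 (summable_const_mul_half_pow_rpow C (half_pos hγ))) (fun k => ?_)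
    (A := fun k => {V : Grassmannian n m |
      HasCover (V.proj '' E) ((1 / 2) ^ (k + k₀)) (2 * ((1 / 2) ^ (k + k₀)) ^ θ) q (1 / 2)})
    fun V hV => ?_
  · obtain ⟨h1, h2, h3, h4⟩ := hsub ⟨by positivity, (hpow k).trans_lt hk₀⟩
    exact hcov _ h2 h3 h4 h1
  · refine frequently_atTop.2 fun K => ?_
    have h1 : ∀ᶠ r : ℝ in 𝓝[>] 0, r < (1 / 2) ^ (K + k₀) :=
      mem_nhdsWithin_of_mem_nhds (Iio_mem_nhds (by positivity))
    obtain ⟨r, hr, hrK, hr0, hr1⟩ :=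
      ((show ∃ᶠ r : ℝ in 𝓝[>] 0, HasCover (V.proj '' E) r (r ^ θ) q (1 / 2) from
        hV).and_eventually (h1.and eventually_small)).exists
    obtain ⟨j, hj1, hj2⟩ := exists_nat_pow_near_of_lt_one hr0 hr1.le
      (by norm_num : (0 : ℝ) < 1 / 2) (by norm_num)
    have hjK : K + k₀ < j + 1 :=
      (pow_lt_pow_iff_right_of_lt_one₀ (by norm_num) (by norm_num)).1 (hj1.trans hrK)
    obtain ⟨i, hi⟩ := Nat.exists_eq_add_of_le' (show k₀ ≤ j + 1 by omega)
    refine ⟨i, by omega, ?_⟩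
    change HasCover (V.proj '' E) ((1 / 2) ^ (i + k₀)) (2 * ((1 / 2) ^ (i + k₀)) ^ θ) q (1 / 2)
    rw [← hi]
    refine hr.mono hj1.le ?_ le_rfl
    have h5 : r ≤ 2 * (1 / 2) ^ (j + 1) := by rw [pow_succ]; linarith
    calc r ^ θ ≤ (2 * (1 / 2) ^ (j + 1)) ^ θ := Real.rpow_le_rpow hr0.le h5 hθ.le
      _ = 2 ^ θ * ((1 / 2) ^ (j + 1)) ^ θ := Real.mul_rpow (by norm_num) (by positivity)
      _ ≤ 2 * ((1 / 2) ^ (j + 1)) ^ θ := by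
          gcongr
          simpa using Real.rpow_le_rpow_of_exponent_le (by norm_num : (1 : ℝ) ≤ 2) hθ1

theorem eventually_not_hasCover (hmn : m = n) (hθ1 : θ ≤ 1) (hq : 0 ≤ q)
    (hql : q < lam) (hlam_le : lam ≤ m) (hγ : 0 < γ) (V : Grassmannian n m) :
    ∀ᶠ r : ℝ in 𝓝[>] 0, r ^ (-(q + 2 * γ)) ≤ (capacity r θ q lam E).toReal →
      ¬ HasCover (V.proj '' E) r (r ^ θ) q (1 / 2) := by
  filter_upwards [eventually_scale_small m hγ] with r hr hcap hcov
  refine not_hasCover_of_le_capacity hmn hr.1 hr.2.1 hθ1 hq hql.le hlam_le hr.2.2 hcap V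
    (hcov.mono le_rfl ?_ le_rfl)
  have := Real.rpow_pos_of_pos hr.1 θ
  linarith

/-- Countable stability of dimension: a rational q in the gap makes the strict inequality uniform on
each of countably many pieces. -/
theorem hausdorffDimLE_of_rational_levels {X : Type*} [MetricSpace X] {S : Set X} {d : ℝ}
    (hd : 0 ≤ d) (s₀ : ℝ) (f : X → ℝ) (A : ℝ → Set X) (hf : ∀ x, 0 ≤ f x)
    (hS : ∀ x ∈ S, f x < s₀) (hA : ∀ x q, f x < q → x ∈ A q)
    (hdim : ∀ q, 0 ≤ q → q < s₀ → dimH (A q) ≤ ENNReal.ofReal d) : HausdorffDimLE S d := by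
  intro _
  have hsub : S ⊆ ⋃ q ∈ {q : ℚ | 0 ≤ (q : ℝ) ∧ (q : ℝ) < s₀}, A q := fun x hx => by
    obtain ⟨q, h1, h2⟩ := exists_rat_btwn (hS x hx)
    exact mem_iUnion₂.2 ⟨q, ⟨(hf x).trans h1.le, h2⟩, hA x q h1⟩
  have h1 : dimH S ≤ ENNReal.ofReal d := by
    refine (dimH_mono hsub).trans ?_
    rw [dimH_bUnion (to_countable _)]
    exact iSup₂_le fun q hq => hdim q hq.1 hq.2
  have h2 : ((dimH S : ℝ≥0∞) : EReal) ≤ ((ENNReal.ofReal d : ℝ≥0∞) : EReal) := by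
    exact_mod_cast h1
  rwa [EReal.coe_ennreal_ofReal, max_eq_left hd] at h2

end Exceptional

theorem upperIntermediateDim_nonneg (θ : ℝ) (F : Set (RSpace n)) :
    0 ≤ upperIntermediateDim θ F :=
  Real.sInf_nonneg fun _ h => h.1

theorem lowerIntermediateDim_nonneg (θ : ℝ) (F : Set (RSpace n)) :
    0 ≤ lowerIntermediateDim θ F :=
  Real.sInf_nonneg fun _ h => h.1

/-! ### The main theorem. -/

theorem theorem3p8 (n m : ℕ) (hm : 1 ≤ m) (hmn : m ≤ n) (θ : ℝ) (hθ : 0 < θ) (hθ1 : θ ≤ 1)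
    (lam : ℝ) (hlam : 0 ≤ lam) (hlam_le : lam ≤ m)
    (E : Set (RSpace n)) (hE : IsCompact E) (hne : E.Nonempty) :
    HausdorffDimLE
        {V : Grassmannian n m | upperIntermediateDim θ (V.proj '' E) < upperProfile θ lam E}
        ((m : ℝ) * ((n : ℝ) - m) - ((m : ℝ) - lam)) ∧
      HausdorffDimLE
        {V : Grassmannian n m | lowerIntermediateDim θ (V.proj '' E) < lowerProfile θ lam E}
        ((m : ℝ) * ((n : ℝ) - m) - ((m : ℝ) - lam)) := by
  have hn : 1 ≤ n := hm.trans hmn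
  have hbdd : ∀ V : Grassmannian n m, Bornology.IsBounded (V.proj '' E) := fun V =>
    (hE.image V.proj.continuous).isBounded
  have hupper := fun q => frequently_le_capacity_of_lt_upperProfile (q := q) hθ hθ1 hlam hE hne
  have hlower := fun q => eventually_le_capacity_of_lt_lowerProfile (q := q) hθ hθ1 hlam hE hne
  -- Only for m = n can the bound be negative; there the sets are shown to be empty.
  rcases hmn.eq_or_lt with heq | hlt
  · constructor
    · rintro ⟨V, hV⟩
      rw [mem_ofPred_eq] at hV
      obtain ⟨q, h1, h2⟩ := exists_between hV
      have hq := (upperIntermediateDim_nonneg θ _).trans h1.le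
      obtain ⟨hql, γ, hγ, hcap⟩ := hupper q hq h2
      obtain ⟨r, hr, h3, h4⟩ := (hcap.and_eventually
        ((eventually_not_hasCover heq hθ1 hq hql hlam_le hγ V).and
          (eventually_hasCover_of_upperIntermediateDim_lt hn hθ hθ1 (hbdd V) h1))).exists
      exact absurd h4 (h3 hr)
    · rintro ⟨V, hV⟩
      rw [mem_ofPred_eq] at hV
      obtain ⟨q, h1, h2⟩ := exists_between hV
      have hq := (lowerIntermediateDim_nonneg θ _).trans h1.le
      obtain ⟨hql, γ, hγ, hcap⟩ := hlower q hq h2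
      obtain ⟨r, hr, h3, h4⟩ :=
        ((frequently_hasCover_of_lowerIntermediateDim_lt hn hθ hθ1 (hbdd V) h1).and_eventually
          ((eventually_not_hasCover heq hθ1 hq hql hlam_le hγ V).and hcap)).exists
      exact absurd hr (h3 h4)
  · have hD : (m : ℝ) * ((n : ℝ) - m) - ((m : ℝ) - lam) =
        ((m * (n - m - 1) : ℕ) : ℝ) + lam := by
      obtain ⟨k, rfl⟩ := Nat.exists_eq_add_of_lt hlt
      rw [show m + k + 1 - m - 1 = k by omega]
      push_cast
      ring
    rw [hD]
    constructor
    · refine hausdorffDimLE_of_rational_levels (by positivity) _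
        (fun V : Grassmannian n m => upperIntermediateDim θ (V.proj '' E)) _
        (fun V => upperIntermediateDim_nonneg θ _) (fun V hV => hV)
        (fun V q hq => eventually_hasCover_of_upperIntermediateDim_lt hn hθ hθ1 (hbdd V) hq)
        fun q hq hqs => ?_
      obtain ⟨hql, γ, hγ, hcap⟩ := hupper q hq hqs
      exact dimH_eventually_exceptional_le hlt hθ1 hq hql hlam_le hE hγ hcap
    · refine hausdorffDimLE_of_rational_levels (by positivity) _
        (fun V : Grassmannian n m => lowerIntermediateDim θ (V.proj '' E)) _
        (fun V => lowerIntermediateDim_nonneg θ _) (fun V hV => hV)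
        (fun V q hq => frequently_hasCover_of_lowerIntermediateDim_lt hn hθ hθ1 (hbdd V) hq)
        fun q hq hqs => ?_
      obtain ⟨hql, γ, hγ, hcap⟩ := hlower q hq hqs
      exact dimH_frequently_exceptional_le hlt hθ hθ1 hq hql hlam_le hE hγ hcap
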